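/- Let $\lambda\in\mathbb{C}$ with $|\lambda|<1$, let $\mathbb{T}^2=\{(z_1,z_2)\in\mathbb{C}^2:|z_1|=|z_2|=1\}$ be the unit torus with normalised Haar measure $\mu$, and let $T:\mathbb{T}^2\to\mathbb{T}^2$ be the map $$T(z_1,z_2)=\left(z_1\,\frac{z_1-\lambda}{1-\bar\lambda z_1}\,z_2,\ \frac{z_1-\lambda}{1-\bar\lambda z_1}\,z_2\right).$$ For functions $g,h:\mathbb{T}^2\to\mathbb{C}$ that extend analytically to an open neighbourhood of $\mathbb{T}^2$ in $\mathbb{C}^2$, put $$C_{gh}(k)=\int g\cdot (h\circ T^k)\,d\mu-\int g\,d\mu\int h\,d\mu\qquad(k\ge 0).$$ Let $R_\lambda=\{(-\lambda)^n:n\ge 1\}\cup\{(-\bar\lambda)^n:n\ge 1\}$. For all such $g,h$ the series $\hat C_{gh}(\zeta)=\sum_{k=0}^\infty \zeta^{-k}C_{gh}(k)$ converges absolutely for every $\zeta\in\mathbb{C}$ with $|\zeta|>1$, and $\hat C_{gh}$ has a meromorphic continuation to $\mathbb{C}\setminus\{0\}$ that is analytic at every point of $\mathbb{C}\setminus\{0\}$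 outside $R_\lambda$, so that all its poles lie in $R_\lambda$. Moreover every non-zero point of $R_\lambda$ is a pole of the meromorphic continuation of $\hat C_{gh}$ for some such $g,h$. Thus the set of all poles in $\mathbb{C}\setminus\{0\}$ of these continuations, over all such $g$ and $h$, is exactly $R_\lambda\setminus\{0\}$. -/

import Mathlib

open MeasureTheory Filter Topology

noncomputable section

namespace BlaschkeTorus

/-- The unit torus `𝕋²`, a compact abelian group. -/
abbrev Torus : Type := Circle × Circle

/-- The Blaschke factor `z ↦ (z - l) / (1 - l̄ z)` preserves the unit circle when `|l| < 1`. -/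
theorem norm_blaschke {l : ℂ} (hl : ‖l‖ < 1) (z : Circle) :
    ‖((z : ℂ) - l) / (1 - (starRingEnd ℂ) l * z)‖ = 1 := by
  have hz : (z : ℂ) * (starRingEnd ℂ) (z : ℂ) = 1 := by
    rw [Complex.mul_conj]; simp
  have h1 : ‖(z : ℂ) - l‖ = ‖1 - (starRingEnd ℂ) l * z‖ := by
    rw [← Complex.norm_conj (1 - (starRingEnd ℂ) l * z)]
    have h2 : (z : ℂ) - l = z * (starRingEnd ℂ) (1 - (starRingEnd ℂ) l * z) := by
      simp only [map_sub, map_one, map_mul, Complex.conj_conj]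
      linear_combination l * hz
    conv_lhs => rw [h2]
    rw [norm_mul, Circle.norm_coe, one_mul]
  have h0 : (z : ℂ) - l ≠ 0 := by
    intro h
    have h3 : ‖l‖ = 1 := by rw [← sub_eq_zero.mp h, Circle.norm_coe]
    linarith
  rw [norm_div, ← h1, div_self (norm_ne_zero_iff.mpr h0)]

/-- The Blaschke factor `z ↦ (z - l) / (1 - l̄ z)` as a self-map of the unit circle. -/
def blaschke (l : ℂ) (hl : ‖l‖ < 1) (z : Circle) : Circle :=
  ⟨((z : ℂ) - l) / (1 - (starRingEnd ℂ) l * z), by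
    simpa [Submonoid.unitSphere] using norm_blaschke hl z⟩

/-- The map `T(z₁, z₂) = (z₁ b(z₁) z₂, b(z₁) z₂)` of the torus, with `b` the Blaschke factor. -/
def T (l : ℂ) (hl : ‖l‖ < 1) (z : Torus) : Torus :=
  (z.1 * blaschke l hl z.1 * z.2, blaschke l hl z.1 * z.2)

/-- The Borel `σ`-algebra of the unit circle. -/
instance : MeasurableSpace Circle := borel Circle

instance : BorelSpace Circle := ⟨rfl⟩

/-- Normalised Haar measure on the torus (total mass one). -/
def haar : Measure Torus := Measure.haarMeasure ⊤

/-- `g : 𝕋² → ℂ` is the restriction of a function that is analytic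
on an open neighbourhood of the unit torus in `ℂ²`. -/
def AnalyticNearTorus (g : Torus → ℂ) : Prop :=
  ∃ (U : Set (ℂ × ℂ)) (G : ℂ × ℂ → ℂ), IsOpen U ∧ AnalyticOnNhd ℂ G U ∧
    ∀ z : Torus, ((z.1 : ℂ), (z.2 : ℂ)) ∈ U ∧ G ((z.1 : ℂ), (z.2 : ℂ)) = g z

/-- The correlation function `C_gh(k) = ∫ g · h ∘ T^k dμ - ∫ g dμ ∫ h dμ`. -/
def correlation (l : ℂ) (hl : ‖l‖ < 1) (g h : Torus → ℂ) (k : ℕ) : ℂ :=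
  ∫ z, g z * h ((T l hl)^[k] z) ∂haar - (∫ z, g z ∂haar) * ∫ z, h z ∂haar

/-- The `Z`-transform `ζ ↦ ∑_{k ≥ 0} ζ^{-k} c(k)` (meaningful where the series converges). -/
def zTransform (c : ℕ → ℂ) (ζ : ℂ) : ℂ := ∑' k : ℕ, ζ ^ (-(k : ℤ)) * c k

/-- `F` is meromorphic on `ℂ ∖ {0}` and agrees with the `Z`-transform of `c` on `|ζ| > 1`. -/
def IsMeromorphicContinuation (c : ℕ → ℂ) (F : ℂ → ℂ) : Prop :=
  MeromorphicOn F {0}ᶜ ∧ ∀ ζ : ℂ, 1 < ‖ζ‖ → F ζ = zTransform c ζ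

/-- `F` has a pole at `w`. -/
def IsPole (F : ℂ → ℂ) (w : ℂ) : Prop := MeromorphicAt F w ∧ meromorphicOrderAt F w < 0

/-- The set `{(-l)^n : n ≥ 1} ∪ {(-l̄)^n : n ≥ 1}`. -/
def resonances (l : ℂ) : Set ℂ :=
  {w | ∃ n : ℕ, 1 ≤ n ∧ w = (-l) ^ n} ∪ {w | ∃ n : ℕ, 1 ≤ n ∧ w = (-(starRingEnd ℂ) l) ^ n}

end BlaschkeTorus

end

/-! Write `b` for the Blaschke factor. Composing the character with exponent `n` with `T` gives
`z₁^{n₁} b(z₁)^m z₂^m`, where `m = n₁ + n₂`. Since `b` is analytic on the closed disc, `b^m`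
contains only powers `z₁^j` with `j` of the same sign as `m`. On characters, composition with `T` is
therefore an infinite matrix sending `n` to the exponents `(n₁ + j, n₁ + n₂)`, and the correlations
of `g` with the iterated characters obey the corresponding linear recursion.

The sign rule makes this matrix triangular with respect to three regions: the stable cone
(coordinates of opposite signs), the axis `n₁ = 0`, and the unstable cone. The unstable cone is
invariant, and a point of the axis leads only to itself or into the unstable cone. For `n ≠ 0` the
only loops are those on the axis at `(0, s)`, with entry the constant term of `b^s`, namely `(-l)^s`
or `(-l̄)^{|s|}`.

For given `ε`, a weight makes the matrix a sum of an operator of norm at most `ε` and finitely many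
loops (`exists_weight`): an anisotropic weight makes all rows with large `n` small
(`exists_tsum_koopmanMatrix_le`), and a bounded height takes care of the others. Triangularity then
shows that multiplying the generating series in `x = ζ⁻¹` by the product of the factors `1 - x μ_s`
over the loops removes all singularities in `|x| < ε⁻¹` (`exists_analytic_extension`). Analyticity
near the torus gives exponentially decaying Fourier coefficients
(`AnalyticNearTorus.exists_series`), so the data fit the weighted space for some `q < 1`. The
continuations for different `ε` are glued in `exists_continuation`.

Conversely, for `g`, `h` the characters `(0, -s)` and `(0, s)`, triangularity reduces the
correlations to the powers of the loop entry (`correlation_axis`), whose transform is `ζ / (ζ - w)`.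
-/

noncomputable section

namespace BlaschkeTorus

/-! ### Resolvents of contracting matrices perturbed by finitely many loops -/

section Matrix
open scoped ENNReal
variable {ι : Type*}

/-- A matrix with uniformly summable rows, acting on bounded functions. -/
def matrixCLM (N : ι → ι → ℂ) {ε : ℝ} (hN : ∀ n, Summable fun n' => ‖N n n'‖)
    (hb : ∀ n, ∑' n', ‖N n n'‖ ≤ ε) :
    lp (fun _ : ι => ℂ) ∞ →L[ℂ] lp (fun _ : ι => ℂ) ∞ :=
  have hs : ∀ (f : lp (fun _ : ι => ℂ) ∞) (n : ι),
      Summable fun n' => ‖N n n' * f n'‖ := fun f n =>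
    Summable.of_nonneg_of_le (fun _ => norm_nonneg _)
      (fun n' => by
        rw [norm_mul]
        exact mul_le_mul_of_nonneg_left (lp.norm_apply_le_norm ENNReal.top_ne_zero f n')
          (norm_nonneg _)) ((hN n).mul_right ‖f‖)
  have hle : ∀ (f : lp (fun _ : ι => ℂ) ∞) (n : ι), ‖∑' n', N n n' * f n'‖ ≤ ε * ‖f‖ :=
    fun f n => by
      refine (norm_tsum_le_tsum_norm (hs f n)).trans ?_
      refine ((hs f n).tsum_le_tsum (fun n' => ?_) ((hN n).mul_right ‖f‖)).trans ?_
      · rw [norm_mul]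
        exact mul_le_mul_of_nonneg_left (lp.norm_apply_le_norm ENNReal.top_ne_zero f n')
          (norm_nonneg _)
      · rw [tsum_mul_right]
        exact mul_le_mul_of_nonneg_right (hb n) (norm_nonneg _)
  LinearMap.mkContinuousOfExistsBound
    { toFun := fun f => ⟨fun n => ∑' n', N n n' * f n',
        memℓp_infty ⟨ε * ‖f‖, by rintro _ ⟨n, rfl⟩; exact hle f n⟩⟩
      map_add' := fun f g => by
        ext n
        simp only [lp.coeFn_add, Pi.add_apply, mul_add]
        exact (hs f n).of_norm.tsum_add (hs g n).of_norm
      map_smul' := fun c f => by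
        ext n
        simp only [lp.coeFn_smul, Pi.smul_apply, smul_eq_mul, RingHom.id_apply]
        rw [← tsum_mul_left]
        congr 1
        ext n'
        ring }
    ⟨max ε 0, fun f => lp.norm_le_of_forall_le (by positivity) fun n =>
      (hle f n).trans (mul_le_mul_of_nonneg_right (le_max_left _ _) (norm_nonneg _))⟩

theorem matrixCLM_apply (N : ι → ι → ℂ) {ε : ℝ} (hN : ∀ n, Summable fun n' => ‖N n n'‖)
    (hb : ∀ n, ∑' n', ‖N n n'‖ ≤ ε) (f : lp (fun _ : ι => ℂ) ∞) (n : ι) :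
    matrixCLM N hN hb f n = ∑' n', N n n' * f n' := rfl

theorem norm_matrixCLM_apply_le (N : ι → ι → ℂ) {ε : ℝ}
    (hN : ∀ n, Summable fun n' => ‖N n n'‖) (hb : ∀ n, ∑' n', ‖N n n'‖ ≤ ε) (n : ι)
    (f : lp (fun _ : ι => ℂ) ∞) {B : ℝ} (hB : ∀ n', N n n' ≠ 0 → ‖f n'‖ ≤ B) (hB0 : 0 ≤ B) :
    ‖matrixCLM N hN hb f n‖ ≤ ε * B := by
  rw [matrixCLM_apply]
  have hle : ∀ n', ‖N n n' * f n'‖ ≤ ‖N n n'‖ * B := fun n' => by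
    rw [norm_mul]
    by_cases h : N n n' = 0
    · simp [h]
    · exact mul_le_mul_of_nonneg_left (hB n' h) (norm_nonneg _)
  refine (tsum_of_norm_bounded ((hN n).mul_right B).hasSum hle).trans ?_
  rw [tsum_mul_right]
  exact mul_le_mul_of_nonneg_right (hb n) hB0

theorem norm_matrixCLM_le (N : ι → ι → ℂ) {ε : ℝ} (hε : 0 ≤ ε)
    (hN : ∀ n, Summable fun n' => ‖N n n'‖) (hb : ∀ n, ∑' n', ‖N n n'‖ ≤ ε) :
    ‖matrixCLM N hN hb‖ ≤ ε :=
  ContinuousLinearMap.opNorm_le_bound _ hε fun f =>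
    lp.norm_le_of_forall_le (by positivity) fun n =>
      norm_matrixCLM_apply_le N hN hb n f
        (fun n' _ => lp.norm_apply_le_norm ENNReal.top_ne_zero f n') (norm_nonneg _)

/-- Pairing a bounded function with a summable one. -/
def pairingCLM (h : ι → ℂ) (hh : Summable fun n => ‖h n‖) :
    lp (fun _ : ι => ℂ) ∞ →L[ℂ] ℂ :=
  have hle : ∀ (f : lp (fun _ : ι => ℂ) ∞) (n : ι), ‖h n * f n‖ ≤ ‖h n‖ * ‖f‖ := fun f n => by
    rw [norm_mul]
    exact mul_le_mul_of_nonneg_left (lp.norm_apply_le_norm ENNReal.top_ne_zero f n)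
          (norm_nonneg _)
  have hs : ∀ (f : lp (fun _ : ι => ℂ) ∞), Summable fun n => h n * f n := fun f =>
    Summable.of_norm_bounded (hh.mul_right ‖f‖) (hle f)
  LinearMap.mkContinuousOfExistsBound
    { toFun := fun f => ∑' n, h n * f n
      map_add' := fun f g => by
        simp only [lp.coeFn_add, Pi.add_apply, mul_add]
        exact (hs f).tsum_add (hs g)
      map_smul' := fun c f => by
        simp only [lp.coeFn_smul, Pi.smul_apply, smul_eq_mul, RingHom.id_apply]
        rw [← tsum_mul_left]
        congr 1
        ext n'
        ring }
    ⟨∑' n, ‖h n‖, fun f => by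
      rw [← tsum_mul_right]
      exact tsum_of_norm_bounded (hh.mul_right ‖f‖).hasSum (hle f)⟩

theorem pairingCLM_apply (h : ι → ℂ) (hh : Summable fun n => ‖h n‖)
    (f : lp (fun _ : ι => ℂ) ∞) : pairingCLM h hh f = ∑' n, h n * f n := rfl

/-- Evaluation at a point, as a continuous functional on bounded functions. -/
def evalAtCLM (s : ι) : lp (fun _ : ι => ℂ) ∞ →L[ℂ] ℂ :=
  LinearMap.mkContinuous
    { toFun := fun f => f s
      map_add' := fun _ _ => rfl
      map_smul' := fun _ _ => rfl } 1 fun f => by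
      rw [one_mul]
      exact lp.norm_apply_le_norm ENNReal.top_ne_zero f s

theorem evalAtCLM_apply (s : ι) (f : lp (fun _ : ι => ℂ) ∞) : evalAtCLM s f = f s := rfl

/-- If a bounded function is reproduced on `Q` by a strictly contracting matrix for which `Q` is
invariant, then it vanishes on `Q`. -/
theorem eq_zero_of_invariant (N : ι → ι → ℂ) {ε : ℝ} (hε : 0 < ε)
    (hN : ∀ n, Summable fun n' => ‖N n n'‖) (hb : ∀ n, ∑' n', ‖N n n'‖ ≤ ε)
    {Q : Set ι} (hQ : ∀ n ∈ Q, ∀ n', N n n' ≠ 0 → n' ∈ Q) {x : ℂ} (hx : ‖x‖ < ε⁻¹)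
    (u : lp (fun _ : ι => ℂ) ∞) (hu : ∀ n ∈ Q, u n = x * matrixCLM N hN hb u n) :
    ∀ n ∈ Q, u n = 0 := by
  have hr : ‖x‖ * ε < 1 := by rwa [← lt_div_iff₀ hε, one_div]
  have key : ∀ k : ℕ, ∀ n ∈ Q, ‖u n‖ ≤ (‖x‖ * ε) ^ k * ‖u‖ := by
    intro k
    induction k with
    | zero => intro n _; simpa using lp.norm_apply_le_norm ENNReal.top_ne_zero u n
    | succ k ih =>
      intro n hn
      rw [hu n hn, norm_mul, pow_succ']
      calc _ ≤ ‖x‖ * (ε * ((‖x‖ * ε) ^ k * ‖u‖)) := by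
            gcongr
            exact norm_matrixCLM_apply_le N hN hb n u (fun n' h => ih n' (hQ n hn n' h))
              (by positivity)
        _ = _ := by ring
  intro n hn
  have hlim : Tendsto (fun k : ℕ => (‖x‖ * ε) ^ k * ‖u‖) atTop (𝓝 0) := by
    simpa using (tendsto_pow_atTop_nhds_zero_of_lt_one (by positivity) hr).mul_const ‖u‖
  exact norm_le_zero_iff.mp (ge_of_tendsto' hlim fun k => key k n hn)

theorem smul_pow_apply {E : Type*} [NormedAddCommGroup E] [NormedSpace ℂ E] (L : E →L[ℂ] E)
    (x : ℂ) (k : ℕ) (f : E) : ((x • L) ^ k) f = x ^ k • (L ^ k) f := by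
  rw [smul_pow, smul_apply]

-- The full operator is `L = T + D` with `‖T‖ ≤ ε` and `D` the finite-rank diagonal part on `S`. The
-- resolvent of `T` is analytic for `‖x‖ < ε⁻¹`, and that of `L` is a finite-rank correction of it.
-- As `T` sends rows of `S` into the invariant set `Q`, which is disjoint from `S`, the correction
-- is diagonal on `S`, so its denominator is exactly the product of the factors `1 - x μ s`.
set_option maxHeartbeats 800000 in
theorem exists_analytic_extension [DecidableEq ι] (N : ι → ι → ℂ) {ε : ℝ} (hε : 0 < ε)
    (hN : ∀ n, Summable fun n' => ‖N n n'‖) (hb : ∀ n, ∑' n', ‖N n n'‖ ≤ ε)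
    (S : Finset ι) (Q : Set ι) (hSQ : ∀ s ∈ S, s ∉ Q)
    (hQ : ∀ n ∈ Q, ∀ n', N n n' ≠ 0 → n' ∈ Q) (hS : ∀ n ∈ S, ∀ n', N n n' ≠ 0 → n' ∈ Q)
    (μ : ι → ℂ) (φ : ℕ → ι → ℂ) {C : ℝ} (hφ0 : ∀ n, ‖φ 0 n‖ ≤ C)
    (hφ : ∀ k n, φ (k + 1) n = ∑' n', N n n' * φ k n' + if n ∈ S then μ n * φ k n else 0)
    (h : ι → ℂ) (hh : Summable fun n => ‖h n‖) :
    ∃ G : ℂ → ℂ, AnalyticOnNhd ℂ G (Metric.ball 0 ε⁻¹) ∧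
      ∀ᶠ x in 𝓝 (0 : ℂ), G x = (∏ s ∈ S, (1 - x * μ s)) * ∑' k, x ^ k * ∑' n, h n * φ k n := by
  set T := matrixCLM N hN hb with hT
  have hTn : ‖T‖ ≤ ε := norm_matrixCLM_le N hε.le hN hb
  let δ : ι → lp (fun _ : ι => ℂ) ∞ := fun s => lp.single ∞ s (1 : ℂ)
  have hδ : ∀ s n, δ s n = if n = s then 1 else 0 := fun s n => by
    simp only [δ, lp.coeFn_single, Pi.single_apply]
  let D : lp (fun _ : ι => ℂ) ∞ →L[ℂ] lp (fun _ : ι => ℂ) ∞ :=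
    ∑ s ∈ S, μ s • (evalAtCLM s).smulRight (δ s)
  have hD : ∀ f, D f = ∑ s ∈ S, (μ s * f s) • δ s := fun f => by
    simp [D, evalAtCLM_apply, smul_smul]
  have hDn : ∀ f n, D f n = if n ∈ S then μ n * f n else 0 := fun f n => by
    rw [hD, ← evalAtCLM_apply, map_sum]
    simp [evalAtCLM_apply, hδ]
  set L := T + D with hL
  let f₀ : lp (fun _ : ι => ℂ) ∞ := ⟨φ 0, memℓp_infty ⟨C, by rintro _ ⟨n, rfl⟩; exact hφ0 n⟩⟩
  have hpow : ∀ k n, (L ^ k) f₀ n = φ k n := by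
    intro k
    induction k with
    | zero => intro n; rfl
    | succ k ih =>
      intro n
      rw [pow_succ', mul_apply_eq_comp, hL, _root_.add_apply,
        lp.coeFn_add, Pi.add_apply, ← hL, hDn, hT, matrixCLM_apply, hφ]
      simp only [ih]
  let R : ℂ → (lp (fun _ : ι => ℂ) ∞ →L[ℂ] lp (fun _ : ι => ℂ) ∞) :=
    fun x => Ring.inverse (1 - x • T)
  have hunit : ∀ x ∈ Metric.ball (0 : ℂ) ε⁻¹, IsUnit (1 - x • T) := fun x hx => by
    refine isUnit_one_sub_of_norm_lt_one ?_
    rw [mem_ball_zero_iff] at hx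
    calc ‖x • T‖ ≤ ‖x‖ * ε := by rw [norm_smul]; gcongr
      _ < 1 := by rwa [← lt_div_iff₀ hε, one_div]
  have hRan : AnalyticOnNhd ℂ R (Metric.ball 0 ε⁻¹) := fun x hx => by
    have h1 : AnalyticAt ℂ (fun x : ℂ => 1 - x • T) x := by fun_prop
    have h2 := analyticOnNhd_inverse (𝕜 := ℂ) (1 - x • T) (hunit x hx)
    exact AnalyticAt.comp (f := fun x : ℂ => 1 - x • T) h2 h1
  have hRi : ∀ x ∈ Metric.ball (0 : ℂ) ε⁻¹, ∀ f, R x f - x • T (R x f) = f := fun x hx f => by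
    have := congrArg (fun A => A f) (Ring.mul_inverse_cancel _ (hunit x hx))
    simpa using this
  -- The function `R x (δ s)` satisfies the homogeneous equation on `Q`, hence vanishes there; rows
  -- of `T` indexed by `S` only see `Q`, so on `S` the resolvent leaves `δ s` unchanged.
  have hRδ : ∀ x ∈ Metric.ball (0 : ℂ) ε⁻¹, ∀ s ∈ S, ∀ s' ∈ S,
      R x (δ s) s' = if s' = s then 1 else 0 := fun x hx s hs s' hs' => by
    have heq : ∀ n, R x (δ s) n = δ s n + x * T (R x (δ s)) n := fun n => by
      have h1 : R x (δ s) n - x * T (R x (δ s)) n = δ s n :=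
        congrArg (fun f => evalAtCLM n f) (hRi x hx (δ s))
      rw [← h1, sub_add_cancel]
    have hz := eq_zero_of_invariant N hε hN hb hQ (mem_ball_zero_iff.mp hx) (R x (δ s))
      fun n hn => by
        rw [heq n, hδ, if_neg, zero_add]
        rintro rfl
        exact hSQ _ hs hn
    have hTz : T (R x (δ s)) s' = 0 := by
      refine norm_le_zero_iff.mp ?_
      simpa using norm_matrixCLM_apply_le N hN hb s' (R x (δ s)) (B := 0)
        (fun n' hn' => by rw [hz n' (hS s' hs' n' hn')]; simp) le_rfl
    rw [heq, hTz, hδ]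
    simp
  let P : ℂ → ℂ := fun x => ∏ s ∈ S, (1 - x * μ s)
  -- Chosen so that `c x s = x * μ s * V x s`: then `x • D (V x)` cancels the sources `c x s • δ s`.
  -- This solves `(1 - x L) V = P f₀` without dividing by any `1 - x μ s`.
  let c : ℂ → ι → ℂ := fun x s => x * μ s * (∏ s' ∈ S.erase s, (1 - x * μ s')) * R x f₀ s
  let V : ℂ → lp (fun _ : ι => ℂ) ∞ := fun x => P x • R x f₀ + ∑ s ∈ S, c x s • R x (δ s)
  have hV : ∀ x ∈ Metric.ball (0 : ℂ) ε⁻¹, V x - x • L (V x) = P x • f₀ := fun x hx => by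
    have hVs : ∀ s ∈ S, x * μ s * V x s = c x s := fun s hs => by
      have h1 : V x s = P x * R x f₀ s + c x s := by
        rw [← evalAtCLM_apply s (V x)]
        simp only [V, map_add, map_sum, map_smul, evalAtCLM_apply, smul_eq_mul]
        congr 1
        rw [Finset.sum_eq_single s]
        · rw [hRδ x hx s hs s hs]; simp
        · intro s' hs' hne
          rw [hRδ x hx s' hs' s hs, if_neg hne.symm, mul_zero]
        · exact fun h => (h hs).elim
      rw [h1]
      simp only [P, c, ← Finset.mul_prod_erase S _ hs]
      ring
    have h2 : V x - x • T (V x) = P x • f₀ + ∑ s ∈ S, c x s • δ s := by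
      simp only [V, map_add, map_sum, map_smul, smul_add, Finset.smul_sum]
      rw [add_sub_add_comm, ← Finset.sum_sub_distrib]
      congr 1
      · rw [smul_comm x, ← smul_sub, hRi x hx]
      · refine Finset.sum_congr rfl fun s _ => ?_
        rw [smul_comm x, ← smul_sub, hRi x hx]
    have h3 : x • D (V x) = ∑ s ∈ S, c x s • δ s := by
      rw [hD, Finset.smul_sum]
      refine Finset.sum_congr rfl fun s hs => ?_
      rw [smul_smul, ← hVs s hs]
      ring_nf
    rw [hL, _root_.add_apply, smul_add, h3, ← sub_sub, h2, add_sub_cancel_right]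
  let Λ := pairingCLM h hh
  have hRfan : ∀ f, AnalyticOnNhd ℂ (fun x => R x f) (Metric.ball 0 ε⁻¹) := fun f x hx =>
    AnalyticAt.comp (f := R) (g := fun A => A f)
      ((ContinuousLinearMap.apply ℂ (lp (fun _ : ι => ℂ) ∞) f).analyticAt (R x)) (hRan x hx)
  refine ⟨fun x => Λ (V x), ?_, ?_⟩
  · intro x hx
    refine (Λ.analyticAt _).comp ?_
    have hP : AnalyticAt ℂ P x := by fun_prop
    have hc : ∀ s, AnalyticAt ℂ (fun x => c x s) x := fun s => by
      refine AnalyticAt.mul (by fun_prop) ?_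
      exact ((evalAtCLM s).analyticAt _).comp (hRfan f₀ x hx)
    refine (hP.smul (hRfan f₀ x hx)).add ?_
    exact Finset.analyticAt_fun_sum _ fun s _ => (hc s).smul (hRfan (δ s) x hx)
  -- For small `x` the Neumann series of `L` converges, and it identifies `V x` with the generating
  -- series.
  · have hball : Metric.ball (0 : ℂ) (‖L‖ + 1)⁻¹ ∈ 𝓝 (0 : ℂ) :=
      Metric.ball_mem_nhds _ (by positivity)
    filter_upwards [hball, Metric.ball_mem_nhds (0 : ℂ) (inv_pos.mpr hε)] with x hx hx'
    have hxL : ‖x • L‖ < 1 := by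
      rw [mem_ball_zero_iff] at hx
      rw [norm_smul]
      calc ‖x‖ * ‖L‖ ≤ ‖x‖ * (‖L‖ + 1) := by gcongr; linarith
        _ < 1 := by rwa [← lt_div_iff₀ (by positivity), one_div]
    have hgeo : HasSum (fun k : ℕ => (x • L) ^ k) (∑' k : ℕ, (x • L) ^ k) :=
      (summable_geometric_of_norm_lt_one hxL).hasSum
    have hinv : (∑' k : ℕ, (x • L) ^ k) (P x • f₀) = V x := by
      rw [← hV x hx']
      have := congrArg (fun A => A (V x)) (geom_series_mul_neg (x • L) hxL)
      simpa using this
    have h1 := hgeo.mapL ((ContinuousLinearMap.apply ℂ (lp (fun _ : ι => ℂ) ∞) (P x • f₀)))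
    have h2 := h1.mapL Λ
    simp only [ContinuousLinearMap.apply_apply, hinv] at h2
    rw [← h2.tsum_eq, ← tsum_mul_left]
    congr 1
    ext k
    rw [smul_pow_apply, map_smul, map_smul, map_smul,
      pairingCLM_apply]
    simp only [hpow, smul_eq_mul, P]
    ring

end Matrix

/-! ### Gluing local quotients into a meromorphic continuation -/

section Continuation

theorem eqOn_ball_of_eventuallyEq {f g : ℂ → ℂ} {r : ℝ} (hr : 0 < r)
    (hf : AnalyticOnNhd ℂ f (Metric.ball 0 r)) (hg : AnalyticOnNhd ℂ g (Metric.ball 0 r))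
    (h : f =ᶠ[𝓝 0] g) : Set.EqOn f g (Metric.ball 0 r) :=
  hf.eqOn_of_preconnected_of_eventuallyEq hg (convex_ball 0 r).isPreconnected
    (Metric.mem_ball_self hr) h

theorem analyticOnNhd_tsum_pow_mul {c : ℕ → ℂ} {C : ℝ} (hc : ∀ k, ‖c k‖ ≤ C) :
    AnalyticOnNhd ℂ (fun x => ∑' k, x ^ k * c k) (Metric.ball 0 1) := by
  refine DifferentiableOn.analyticOnNhd (fun x hx => ?_) Metric.isOpen_ball
  have hx' : ‖x‖ < 1 := by simpa using hx
  obtain ⟨r, hxr, hr⟩ := exists_between hx'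
  have hr0 : 0 ≤ r := (norm_nonneg x).trans hxr.le
  have hd : DifferentiableOn ℂ (fun x => ∑' k, x ^ k * c k) (Metric.ball 0 r) := by
    refine Complex.differentiableOn_tsum_of_summable_norm (u := fun k => r ^ k * C)
      ((summable_geometric_of_lt_one hr0 hr).mul_right C)
      (fun k => by fun_prop) Metric.isOpen_ball fun k w hw => ?_
    have hw' : ‖w‖ < r := by simpa using hw
    rw [norm_mul, norm_pow]
    gcongr
    exact hc k
  exact (hd.differentiableAt (Metric.isOpen_ball.mem_nhds (by simpa using hxr))).differentiableWithinAt

theorem summable_zpow_neg_mul {c : ℕ → ℂ} {C : ℝ} (hc : ∀ k, ‖c k‖ ≤ C) {ζ : ℂ}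
    (hζ : 1 < ‖ζ‖) : Summable fun k : ℕ => ζ ^ (-(k : ℤ)) * c k := by
  have hr : ‖ζ‖⁻¹ < 1 := inv_lt_one_of_one_lt₀ hζ
  refine Summable.of_norm_bounded
    ((summable_geometric_of_lt_one (by positivity) hr).mul_right C) fun k => ?_
  rw [norm_mul, zpow_neg, zpow_natCast, norm_inv, norm_pow, inv_pow]
  gcongr
  exact hc k

/-- In the variable `x = ζ⁻¹`, every `ε` provides a quotient `G / P` on `‖ζ‖ > ε`. By the identity
theorem these quotients agree on overlaps after cross-multiplication, and zeros of `P` correspond to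
points of `R`, of which only finitely many lie away from `0`. -/
theorem exists_continuation {c : ℕ → ℂ} {C : ℝ} (hc : ∀ k, ‖c k‖ ≤ C) {R : Set ℂ}
    (hRf : ∀ ε > 0, {w ∈ R | ε ≤ ‖w‖}.Finite) (hR1 : ∀ w ∈ R, ‖w‖ < 1)
    (H : ∀ ε > 0, ∃ P G : ℂ → ℂ, AnalyticOnNhd ℂ P Set.univ ∧
      (∀ x, P x = 0 → ∃ w ∈ R, x * w = 1) ∧ AnalyticOnNhd ℂ G (Metric.ball 0 ε⁻¹) ∧
      ∀ᶠ x in 𝓝 (0 : ℂ), G x = P x * ∑' k, x ^ k * c k) :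
    ∃ F : ℂ → ℂ, IsMeromorphicContinuation c F ∧ ∀ ζ : ℂ, ζ ≠ 0 → ζ ∉ R → AnalyticAt ℂ F ζ := by
  choose! P G hP hP0 hG hGP using H
  have hne : ∀ ε > 0, ∀ ζ : ℂ, ζ ≠ 0 → ζ ∉ R → P ε ζ⁻¹ ≠ 0 := by
    intro ε hε ζ hζ hζR h0
    obtain ⟨w, hw, hw1⟩ := hP0 ε hε _ h0
    refine hζR ?_
    rwa [← (inv_mul_eq_one₀ hζ).mp hw1] at hw
  have hsub : ∀ {a b : ℝ}, 0 < a → a ≤ b → Metric.ball (0 : ℂ) b⁻¹ ⊆ Metric.ball 0 a⁻¹ :=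
    fun ha hab => Metric.ball_subset_ball (inv_anti₀ ha hab)
  have hcons : ∀ a > 0, ∀ b > 0, ∀ x ∈ Metric.ball (0 : ℂ) (max a b)⁻¹,
      P b x * G a x = P a x * G b x := by
    intro a ha b hb
    have hab : 0 < max a b := lt_max_of_lt_left ha
    refine eqOn_ball_of_eventuallyEq (inv_pos.mpr hab)
      (((hP b hb).mono (Set.subset_univ _)).mul ((hG a ha).mono (hsub ha (le_max_left _ _))))
      (((hP a ha).mono (Set.subset_univ _)).mul ((hG b hb).mono (hsub hb (le_max_right _ _)))) ?_
    filter_upwards [hGP a ha, hGP b hb] with x h1 h2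
    simp only [h1, h2]
    ring
  have hser : ∀ a > 0, ∀ x ∈ Metric.ball (0 : ℂ) (max a 1)⁻¹,
      G a x = P a x * ∑' k, x ^ k * c k := by
    intro a ha
    have hab : 0 < max a 1 := lt_max_of_lt_left ha
    exact eqOn_ball_of_eventuallyEq (inv_pos.mpr hab)
      ((hG a ha).mono (hsub ha (le_max_left _ _)))
      (((hP a ha).mono (Set.subset_univ _)).mul
        ((analyticOnNhd_tsum_pow_mul hc).mono (by simpa using hsub one_pos (le_max_right a 1))))
      (hGP a ha)
  -- The cutoff varies with `ζ`, so one formula covers the punctured plane; `hF` replaces it by any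
  -- fixed cutoff below `‖ζ‖`, as long as `ζ ∉ R`.
  let F : ℂ → ℂ := fun ζ => G (min ‖ζ‖ 1 / 2) ζ⁻¹ / P (min ‖ζ‖ 1 / 2) ζ⁻¹
  have hinvmem : ∀ (ζ : ℂ) (a : ℝ), 0 < a → a < ‖ζ‖ → ζ⁻¹ ∈ Metric.ball (0 : ℂ) a⁻¹ :=
    fun ζ a ha h => by
      rw [mem_ball_zero_iff, norm_inv]
      exact inv_strictAnti₀ ha h
  have hF : ∀ a > 0, ∀ ζ : ℂ, a < ‖ζ‖ → ζ ∉ R → F ζ = G a ζ⁻¹ / P a ζ⁻¹ := by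
    intro a ha ζ hζ hζR
    have h0 : 0 < ‖ζ‖ := ha.trans hζ
    have hm : 0 < min ‖ζ‖ 1 / 2 := by positivity
    have hζ0 : ζ ≠ 0 := norm_pos_iff.mp h0
    have := hcons _ hm a ha ζ⁻¹ (hinvmem ζ _ (lt_max_of_lt_left hm)
      (max_lt (by linarith [min_le_left ‖ζ‖ 1]) hζ))
    rw [div_eq_div_iff (hne _ hm ζ hζ0 hζR) (hne a ha ζ hζ0 hζR)]
    linear_combination this
  have hquot : ∀ ζ : ℂ, ζ ≠ 0 → AnalyticAt ℂ (fun z => G (‖ζ‖ / 2) z⁻¹) ζ ∧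
      AnalyticAt ℂ (fun z => P (‖ζ‖ / 2) z⁻¹) ζ := by
    intro ζ hζ
    have h0 : 0 < ‖ζ‖ := norm_pos_iff.mpr hζ
    have hm : 0 < ‖ζ‖ / 2 := by positivity
    have hi : AnalyticAt ℂ (fun z : ℂ => z⁻¹) ζ := analyticAt_inv hζ
    exact ⟨AnalyticAt.comp (f := fun z : ℂ => z⁻¹) (g := G (‖ζ‖ / 2))
        (hG _ hm _ (hinvmem ζ _ hm (by linarith))) hi,
      AnalyticAt.comp (f := fun z : ℂ => z⁻¹) (g := P (‖ζ‖ / 2)) (hP _ hm _ (Set.mem_univ _)) hi⟩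
  -- The point `ζ` itself is excluded because it may lie in `R`, where the value of `F` carries no
  -- information; the other points of `R` stay at a distance by finiteness.
  have hnear : ∀ ζ : ℂ, ζ ≠ 0 → ∀ᶠ z in 𝓝 ζ, z ≠ ζ →
      F z = G (‖ζ‖ / 2) z⁻¹ / P (‖ζ‖ / 2) z⁻¹ := by
    intro ζ hζ
    have h0 : 0 < ‖ζ‖ := norm_pos_iff.mpr hζ
    have hm : 0 < ‖ζ‖ / 2 := by positivity
    have hfin := (hRf _ hm).subset (Set.sdiff_subset (t := {ζ}))
    have h1 : ∀ᶠ z in 𝓝 ζ, z ∉ {w ∈ R | ‖ζ‖ / 2 ≤ ‖w‖} \ {ζ} :=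
      hfin.isClosed.compl_mem_nhds fun h => h.2 rfl
    have h2 : ∀ᶠ z in 𝓝 ζ, ‖ζ‖ / 2 < ‖z‖ :=
      continuous_norm.continuousAt.eventually_const_lt (by linarith)
    filter_upwards [h1, h2] with z hz1 hz2 hzne
    exact hF _ hm z hz2 fun hzR => hz1 ⟨⟨hzR, hz2.le⟩, hzne⟩
  refine ⟨F, ⟨fun ζ hζ => ?_, fun ζ hζ => ?_⟩, fun ζ hζ hζR => ?_⟩
  · obtain ⟨h1, h2⟩ := hquot ζ hζ
    refine (h1.meromorphicAt.div h2.meromorphicAt).congr ?_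
    filter_upwards [eventually_nhdsWithin_of_eventually_nhds (hnear ζ hζ),
      self_mem_nhdsWithin] with z hz hz'
    exact (hz hz').symm
  · have hζ0 : ζ ≠ 0 := norm_pos_iff.mp (one_pos.trans hζ)
    have hζR : ζ ∉ R := fun h => (hR1 ζ h).not_gt hζ
    have hm : (0 : ℝ) < 1 / 2 := by norm_num
    rw [hF (1 / 2) hm ζ (by linarith) hζR, hser _ hm ζ⁻¹, mul_div_cancel_left₀ _
      (hne _ hm ζ hζ0 hζR), zTransform]
    · simp
    · exact hinvmem ζ _ (by positivity) (by norm_num; exact hζ)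
  · obtain ⟨h1, h2⟩ := hquot ζ hζ
    have hm : 0 < ‖ζ‖ / 2 := by have := norm_pos_iff.mpr hζ; positivity
    refine (h1.div h2 (hne _ hm ζ hζ hζR)).congr ?_
    filter_upwards [hnear ζ hζ] with z hz
    by_cases hzζ : z = ζ
    · subst hzζ
      exact (hF _ hm z (by linarith) hζR).symm
    · exact (hz hzζ).symm

end Continuation

/-! ### Exponential decay of Fourier coefficients of functions analytic near the torus -/

section Laurent
open Real (circleAverage)

theorem circleAverage_eq_of_differentiable_on_annulus {f : ℂ → ℂ} {r R : ℝ} (hr : 0 < r)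
    (hrR : r ≤ R) (hf : ∀ z, r ≤ ‖z‖ → ‖z‖ ≤ R → DifferentiableAt ℂ f z) :
    circleAverage f 0 r = circleAverage f 0 R := by
  rw [Real.circleAverage_eq_circleIntegral hr.ne',
    Real.circleAverage_eq_circleIntegral (hr.trans_le hrR).ne',
    Complex.circleIntegral_sub_center_inv_smul_eq_of_differentiable_on_annulus_off_countable hr hrR
      Set.countable_empty]
  · intro z hz
    simp only [Set.mem_sdiff, Metric.mem_closedBall, dist_zero_right, Metric.mem_ball, not_lt] at hz
    exact (hf z hz.2 hz.1).continuousAt.continuousWithinAt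
  · intro z hz
    simp only [Set.mem_sdiff, Metric.mem_closedBall, dist_zero_right, Metric.mem_ball, not_le] at hz
    exact hf z hz.1.2.le hz.1.1.le

theorem norm_circleAverage_le {f : ℂ → ℂ} {r M : ℝ} (hr : 0 ≤ r)
    (hf : ∀ z, ‖z‖ = r → ‖f z‖ ≤ M) : ‖circleAverage f 0 r‖ ≤ M := by
  rw [Real.circleAverage_def, norm_smul]
  have h := intervalIntegral.norm_integral_le_of_norm_le_const (a := 0) (b := 2 * Real.pi)
    (f := fun θ => f (circleMap 0 r θ)) (C := M)
    fun θ _ => hf _ (by simp [abs_of_nonneg hr])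
  have hp := Real.two_pi_pos
  rw [sub_zero, abs_of_pos hp] at h
  rwa [norm_inv, Real.norm_of_nonneg hp.le, inv_mul_le_iff₀ hp, mul_comm (2 * Real.pi)]

/-- The `n`-th Laurent coefficient, computed on the circle of radius `r`. -/
def laurentCoeff (f : ℂ → ℂ) (r : ℝ) (n : ℤ) : ℂ := circleAverage (fun z => z ^ (-n) * f z) 0 r

/-- On the unit circle Laurent coefficients are Fourier coefficients, and a continuous function with
summable Fourier coefficients is the pointwise sum of its series. -/
theorem hasSum_laurentCoeff {f : ℂ → ℂ} (hf : Continuous fun z : Circle => f z)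
    (hs : Summable (laurentCoeff f 1)) (z : Circle) :
    HasSum (fun n => laurentCoeff f 1 n * (z : ℂ) ^ n) (f z) := by
  have : Fact (0 < 2 * Real.pi) := ⟨Real.two_pi_pos⟩
  let F : C(AddCircle (2 * Real.pi), ℂ) :=
    ⟨fun x => f (AddCircle.toCircle x), hf.comp AddCircle.continuous_toCircle⟩
  have hmk : ∀ x : ℝ, ((AddCircle.toCircle (x : AddCircle (2 * Real.pi)) : Circle) : ℂ) =
      circleMap 0 1 x := fun x => by
    rw [AddCircle.toCircle_apply_mk, Circle.coe_exp, circleMap]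
    simp [Real.pi_ne_zero]
  have hfour : ∀ (n : ℤ) (x : AddCircle (2 * Real.pi)),
      (fourier n x : ℂ) = (AddCircle.toCircle x : ℂ) ^ n := fun n x => by
    rw [fourier_apply, AddCircle.toCircle_zsmul, Circle.coe_zpow]
  have hcoeff : fourierCoeff F = laurentCoeff f 1 := by
    ext n
    rw [fourierCoeff_eq_intervalIntegral F n 0, laurentCoeff, Real.circleAverage_def, zero_add,
      one_div]
    congr 1
    refine intervalIntegral.integral_congr fun x _ => ?_
    simp only [hfour, hmk, smul_eq_mul, F, ContinuousMap.coe_mk]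
  have h := has_pointwise_sum_fourier_series_of_summable (f := F) (by rwa [hcoeff])
    ((Complex.arg z : ℝ) : AddCircle (2 * Real.pi))
  have hz : AddCircle.toCircle ((Complex.arg z : ℝ) : AddCircle (2 * Real.pi)) = z := by
    rw [AddCircle.toCircle_apply_mk]
    simp [Real.pi_ne_zero, Circle.exp_arg]
  rw [hcoeff] at h
  simpa only [hfour, smul_eq_mul, F, ContinuousMap.coe_mk, hz] using h

theorem laurentCoeff_eq {f : ℂ → ℂ} {ρ : ℝ} (hρ : 1 < ρ)
    (hf : ∀ z, ρ⁻¹ ≤ ‖z‖ → ‖z‖ ≤ ρ → DifferentiableAt ℂ f z) (n : ℤ) {r : ℝ}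
    (hr : ρ⁻¹ ≤ r) (hr' : r ≤ ρ) : laurentCoeff f 1 n = laurentCoeff f r n := by
  have hρ0 : 0 < ρ⁻¹ := by positivity
  have hd : ∀ z, ρ⁻¹ ≤ ‖z‖ → ‖z‖ ≤ ρ → DifferentiableAt ℂ (fun z => z ^ (-n) * f z) z :=
    fun z h1 h2 => by
      have hz : z ≠ 0 := norm_pos_iff.mp (hρ0.trans_le h1)
      exact (differentiableAt_zpow.mpr (Or.inl hz)).mul (hf z h1 h2)
  have h1 : ρ⁻¹ ≤ 1 := (inv_lt_one_of_one_lt₀ hρ).le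
  rw [laurentCoeff, laurentCoeff,
    ← circleAverage_eq_of_differentiable_on_annulus hρ0 h1
      fun z h h' => hd z h (h'.trans hρ.le),
    ← circleAverage_eq_of_differentiable_on_annulus hρ0 hr
      fun z h h' => hd z h (h'.trans hr')]

theorem norm_laurentCoeff_le {f : ℂ → ℂ} {r M : ℝ} (hr : 0 < r)
    (hf : ∀ z, ‖z‖ = r → ‖f z‖ ≤ M) (n : ℤ) : ‖laurentCoeff f r n‖ ≤ r ^ (-n) * M := by
  refine norm_circleAverage_le hr.le fun z hz => ?_
  rw [norm_mul, norm_zpow, hz]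
  exact mul_le_mul_of_nonneg_left (hf z hz) (by positivity)

/-- For each `n` one of the radii `ρ`, `ρ⁻¹` gives exponential decay. -/
theorem exists_radius {ρ : ℝ} (hρ : 1 < ρ) (n : ℤ) :
    ∃ r : ℝ, 0 < r ∧ ρ⁻¹ ≤ r ∧ r ≤ ρ ∧ r ^ (-n) = ρ⁻¹ ^ n.natAbs := by
  have hρ0 : 0 < ρ := one_pos.trans hρ
  have h1 : ρ⁻¹ ≤ ρ := (inv_lt_one_of_one_lt₀ hρ).le.trans hρ.le
  obtain ⟨k, rfl | rfl⟩ := n.eq_nat_or_neg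
  · exact ⟨ρ, hρ0, h1, le_rfl, by simp⟩
  · exact ⟨ρ⁻¹, by positivity, le_rfl, h1, by simp⟩

theorem laurentCoeff_swap {G : ℂ → ℂ → ℂ} {r s : ℝ} (hr : 0 < r) (hs : 0 < s)
    (hG : Continuous fun θ : ℝ × ℝ => G (circleMap 0 r θ.1) (circleMap 0 s θ.2)) (n m : ℤ) :
    laurentCoeff (fun y => laurentCoeff (fun x => G x y) r n) s m =
      laurentCoeff (fun x => laurentCoeff (fun y => G x y) s m) r n := by
  simp only [laurentCoeff, Real.circleAverage_def, Complex.real_smul]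
  simp only [← intervalIntegral.integral_const_mul]
  rw [intervalIntegral_intervalIntegral_swap]
  · congr 1
    ext θ
    congr 1
    ext θ'
    ring
  · have hc : ∀ (r : ℝ), 0 < r → ∀ n : ℤ, Continuous fun θ => circleMap 0 r θ ^ n :=
      fun r hr n => (continuous_circleMap 0 r).zpow₀ n fun θ =>
        Or.inl (circleMap_ne_center hr.ne')
    have hcont : Continuous (Function.uncurry fun θ' θ : ℝ =>
        ((2 * Real.pi)⁻¹ : ℝ) * (circleMap 0 s θ' ^ (-m) * (((2 * Real.pi)⁻¹ : ℝ) *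
          (circleMap 0 r θ ^ (-n) * G (circleMap 0 r θ) (circleMap 0 s θ'))))) :=
      continuous_const.mul (((hc s hs _).comp continuous_fst).mul (continuous_const.mul
        (((hc r hr _).comp continuous_snd).mul (hG.comp continuous_swap))))
    refine IntegrableOn.mono_set (t := Set.uIcc 0 (2 * Real.pi) ×ˢ Set.uIcc 0 (2 * Real.pi))
      (hcont.continuousOn.integrableOn_compact (isCompact_uIcc.prod isCompact_uIcc))
      (Set.prod_mono Set.uIoc_subset_uIcc Set.uIoc_subset_uIcc)

/-- Coefficients are iterated circle averages. Moving each circle to radius `ρ` or `ρ⁻¹`, according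
to the sign of the exponent, gives the decay in both variables at once; Fubini is needed to move the
second circle while the first is already displaced. -/
theorem exists_laurent_series {G : ℂ × ℂ → ℂ} {ρ M : ℝ} (hρ : 1 < ρ)
    (hG : ∀ x y, ρ⁻¹ ≤ ‖x‖ → ‖x‖ ≤ ρ → ρ⁻¹ ≤ ‖y‖ → ‖y‖ ≤ ρ → AnalyticAt ℂ G (x, y))
    (hM : ∀ x y, ρ⁻¹ ≤ ‖x‖ → ‖x‖ ≤ ρ → ρ⁻¹ ≤ ‖y‖ → ‖y‖ ≤ ρ → ‖G (x, y)‖ ≤ M) :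
    ∃ c : ℤ × ℤ → ℂ, (∀ n, ‖c n‖ ≤ M * ρ⁻¹ ^ (n.1.natAbs + n.2.natAbs)) ∧
      ∀ z : Torus, HasSum (fun n => c n * ((z.1 : ℂ) ^ n.1 * (z.2 : ℂ) ^ n.2)) (G (z.1, z.2)) := by
  have hρ0 : 0 < ρ⁻¹ := by positivity
  have hρ1 : ρ⁻¹ < 1 := inv_lt_one_of_one_lt₀ hρ
  have hdx : ∀ y, ρ⁻¹ ≤ ‖y‖ → ‖y‖ ≤ ρ → ∀ x, ρ⁻¹ ≤ ‖x‖ → ‖x‖ ≤ ρ →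
      DifferentiableAt ℂ (fun x => G (x, y)) x := fun y h1 h2 x h3 h4 =>
    (hG x y h3 h4 h1 h2).differentiableAt.comp x (by fun_prop)
  have hdy : ∀ x, ρ⁻¹ ≤ ‖x‖ → ‖x‖ ≤ ρ → ∀ y, ρ⁻¹ ≤ ‖y‖ → ‖y‖ ≤ ρ →
      DifferentiableAt ℂ (fun y => G (x, y)) y := fun x h1 h2 y h3 h4 =>
    (hG x y h1 h2 h3 h4).differentiableAt.comp y (by fun_prop)
  have hcont : ∀ r s, ρ⁻¹ ≤ r → r ≤ ρ → ρ⁻¹ ≤ s → s ≤ ρ → Continuous fun θ : ℝ × ℝ =>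
      G (circleMap 0 r θ.1, circleMap 0 s θ.2) := by
    intro r s h1 h2 h3 h4
    refine continuous_iff_continuousAt.mpr fun θ => ?_
    refine ContinuousAt.comp (f := fun θ : ℝ × ℝ => (circleMap 0 r θ.1, circleMap 0 s θ.2))
      (hG _ _ ?_ ?_ ?_ ?_).continuousAt (by fun_prop) <;>
    simpa [abs_of_nonneg (hρ0.le.trans h1), abs_of_nonneg (hρ0.le.trans h3)]
  let a : ℤ → ℂ → ℂ := fun n y => laurentCoeff (fun x => G (x, y)) 1 n
  have ha : ∀ n y, ‖y‖ = 1 → ‖a n y‖ ≤ ρ⁻¹ ^ n.natAbs * M := by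
    intro n y hy
    obtain ⟨r, hr0, hr1, hr2, hr⟩ := exists_radius hρ n
    have hy1 : ρ⁻¹ ≤ ‖y‖ := by rw [hy]; exact hρ1.le
    have hy2 : ‖y‖ ≤ ρ := by rw [hy]; exact hρ.le
    simp only [a]
    rw [laurentCoeff_eq hρ (hdx y hy1 hy2) n hr1 hr2, ← hr]
    exact norm_laurentCoeff_le hr0 (fun x hx => hM x y (hx ▸ hr1) (hx ▸ hr2) hy1 hy2) n
  let c : ℤ × ℤ → ℂ := fun n => laurentCoeff (a n.1) 1 n.2
  have hc : ∀ n, ‖c n‖ ≤ M * ρ⁻¹ ^ (n.1.natAbs + n.2.natAbs) := by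
    rintro ⟨n, m⟩
    obtain ⟨r, hr0, hr1, hr2, hr⟩ := exists_radius hρ n
    obtain ⟨s, hs0, hs1, hs2, hs⟩ := exists_radius hρ m
    have h1 : c (n, m) = laurentCoeff (fun x => laurentCoeff (fun y => G (x, y)) s m) r n := by
      calc c (n, m) = laurentCoeff (fun y => laurentCoeff (fun x => G (x, y)) r n) 1 m := by
            refine Real.circleAverage_congr_sphere fun y hy => ?_
            have hy : ‖y‖ = 1 := by simpa using hy
            simp only [a]
            rw [laurentCoeff_eq hρ (hdx y (by rw [hy]; exact hρ1.le)
              (by rw [hy]; exact hρ.le)) n hr1 hr2]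
        _ = laurentCoeff (fun x => laurentCoeff (fun y => G (x, y)) 1 m) r n :=
            laurentCoeff_swap (G := fun x y => G (x, y)) hr0 one_pos
              (hcont r 1 hr1 hr2 hρ1.le hρ.le) n m
        _ = _ := by
            refine Real.circleAverage_congr_sphere fun x hx => ?_
            have hx : ‖x‖ = r := by simpa [abs_of_pos hr0] using hx
            simp only
            rw [laurentCoeff_eq hρ (hdy x (hx ▸ hr1) (hx ▸ hr2)) m hs1 hs2]
    rw [h1, pow_add]
    calc _ ≤ r ^ (-n) * (s ^ (-m) * M) := by
          refine norm_laurentCoeff_le hr0 (fun x hx => ?_) n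
          exact norm_laurentCoeff_le hs0 (fun y hy => hM x y (hx ▸ hr1) (hx ▸ hr2)
            (hy ▸ hs1) (hy ▸ hs2)) m
      _ = _ := by rw [hr, hs]; ring
  have hgeom : Summable fun n : ℤ => ρ⁻¹ ^ n.natAbs := by
    refine Summable.of_nat_of_neg ?_ ?_ <;>
    simpa using summable_geometric_of_lt_one hρ0.le hρ1
  have hsum2 : Summable fun n : ℤ × ℤ => M * ρ⁻¹ ^ (n.1.natAbs + n.2.natAbs) := by
    simp only [pow_add]
    exact (hgeom.mul_of_nonneg hgeom (fun _ => by positivity) (fun _ => by positivity)).mul_left M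
  refine ⟨c, hc, fun z => ?_⟩
  have hS : Summable fun n => c n * ((z.1 : ℂ) ^ n.1 * (z.2 : ℂ) ^ n.2) :=
    Summable.of_norm_bounded hsum2 fun n => by simpa [Circle.norm_coe] using hc n
  have hcircle : Continuous fun w : Circle × Circle => G (w.1, w.2) :=
    continuous_iff_continuousAt.mpr fun w => by
      refine ContinuousAt.comp (f := fun w : Circle × Circle => ((w.1 : ℂ), (w.2 : ℂ)))
        (hG _ _ ?_ ?_ ?_ ?_).continuousAt (by fun_prop) <;> simp [Circle.norm_coe, hρ1.le, hρ.le]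
  have hrow : HasSum (fun n => a n z.2 * (z.1 : ℂ) ^ n) (G (z.1, z.2)) := by
    refine hasSum_laurentCoeff (f := fun x => G (x, z.2)) ?_ ?_ z.1
    · exact hcircle.comp (by fun_prop : Continuous fun w : Circle => (w, z.2))
    · exact Summable.of_norm_bounded (hgeom.mul_right M) fun n => ha n _ (Circle.norm_coe _)
  have hcol : ∀ n, HasSum (fun m => c (n, m) * (z.2 : ℂ) ^ m) (a n z.2) := by
    intro n
    refine hasSum_laurentCoeff (f := a n) ?_ ?_ z.2
    · simp only [a, laurentCoeff, Real.circleAverage_def]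
      refine Continuous.const_smul ?_ _
      refine intervalIntegral.continuous_parametric_intervalIntegral_of_continuous' ?_ _ _
      refine Continuous.mul ?_ ?_
      · exact ((continuous_circleMap 0 1).zpow₀ (-n) fun θ =>
          Or.inl (circleMap_ne_center one_ne_zero)).comp continuous_snd
      · refine hcircle.comp (?_ : Continuous fun p : Circle × ℝ => (Circle.exp p.2, p.1)) |>.congr
          fun p => ?_
        · fun_prop
        · simp [Function.comp, circleMap]
    · exact Summable.of_norm_bounded
        (hsum2.comp_injective (Prod.mk_right_injective n)) fun m => hc (n, m)
  have h1 : HasSum (fun n => a n z.2 * (z.1 : ℂ) ^ n)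
      (∑' n, c n * ((z.1 : ℂ) ^ n.1 * (z.2 : ℂ) ^ n.2)) := by
    refine hS.hasSum.prod_fiberwise fun n => ?_
    have he : (fun m => c (n, m) * ((z.1 : ℂ) ^ n * (z.2 : ℂ) ^ m)) =
        fun m => c (n, m) * (z.2 : ℂ) ^ m * (z.1 : ℂ) ^ n := by
      ext m
      ring
    exact he ▸ (hcol n).mul_right ((z.1 : ℂ) ^ n)
  rw [← h1.unique hrow]
  exact hS.hasSum

theorem exists_polyannulus {U : Set (ℂ × ℂ)} (hU : IsOpen U)
    (hT : ∀ z : Torus, ((z.1 : ℂ), (z.2 : ℂ)) ∈ U) :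
    ∃ ρ : ℝ, 1 < ρ ∧ ∀ x y : ℂ, ρ⁻¹ ≤ ‖x‖ → ‖x‖ ≤ ρ → ρ⁻¹ ≤ ‖y‖ → ‖y‖ ≤ ρ → (x, y) ∈ U := by
  let e : Torus → ℂ × ℂ := fun z => (z.1, z.2)
  have hK : IsCompact (Set.range e) := isCompact_range (by fun_prop)
  obtain ⟨δ, hδ, hsub⟩ := hK.exists_thickening_subset_open hU
    (by rintro _ ⟨z, rfl⟩; exact hT z)
  refine ⟨1 + δ / 2, by linarith, fun x y hx1 hx2 hy1 hy2 => hsub ?_⟩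
  -- The nearby point of the circle is the radial projection `x / ‖x‖`, at distance `|‖x‖ - 1|`.
  have key : ∀ x : ℂ, (1 + δ / 2)⁻¹ ≤ ‖x‖ → ‖x‖ ≤ 1 + δ / 2 →
      ∃ u : Circle, dist x u < δ := by
    intro x h1 h2
    have hx : 0 < ‖x‖ := lt_of_lt_of_le (by positivity) h1
    refine ⟨⟨x / ‖x‖, by simp [Submonoid.unitSphere, hx.ne']⟩, ?_⟩
    have hx' : (‖x‖ : ℂ) ≠ 0 := by exact_mod_cast hx.ne'
    have h3 : x - x / ‖x‖ = x / ‖x‖ * ((‖x‖ - 1 : ℝ) : ℂ) := by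
      push_cast
      field_simp
    have h4 : 1 - δ / 2 ≤ (1 + δ / 2)⁻¹ := by
      rw [← one_div, le_div_iff₀ (by positivity)]
      nlinarith
    rw [dist_eq_norm]
    simp only
    rw [h3, norm_mul, norm_div, Complex.norm_real, Complex.norm_real, norm_norm,
      div_self hx.ne', one_mul, Real.norm_eq_abs, abs_lt]
    constructor <;> linarith
  obtain ⟨u, hu⟩ := key x hx1 hx2
  obtain ⟨v, hv⟩ := key y hy1 hy2
  exact Metric.mem_thickening_iff.mpr ⟨e (u, v), ⟨_, rfl⟩, by
    rw [Prod.dist_eq]; exact max_lt hu hv⟩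

theorem AnalyticNearTorus.exists_series {g : Torus → ℂ} (hg : AnalyticNearTorus g) :
    ∃ (c : ℤ × ℤ → ℂ) (q C : ℝ), 0 < q ∧ q < 1 ∧
      (∀ n, ‖c n‖ ≤ C * q ^ (n.1.natAbs + n.2.natAbs)) ∧
      ∀ z : Torus, HasSum (fun n => c n * ((z.1 : ℂ) ^ n.1 * (z.2 : ℂ) ^ n.2)) (g z) := by
  obtain ⟨U, G, hU, hG, hUG⟩ := hg
  obtain ⟨ρ, hρ, hρU⟩ := exists_polyannulus hU fun z => (hUG z).1
  let K : Set ℂ := Metric.closedBall 0 ρ \ Metric.ball 0 ρ⁻¹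
  have hKmem : ∀ x : ℂ, x ∈ K ↔ ‖x‖ ≤ ρ ∧ ρ⁻¹ ≤ ‖x‖ := fun x => by simp [K]
  have hK : IsCompact K := (isCompact_closedBall 0 ρ).diff Metric.isOpen_ball
  have hGc : ContinuousOn G (K ×ˢ K) := fun p hp => by
    have h1 := (hKmem _).mp hp.1
    have h2 := (hKmem _).mp hp.2
    exact (hG p (hρU p.1 p.2 h1.2 h1.1 h2.2 h2.1)).continuousAt.continuousWithinAt
  obtain ⟨M, hM⟩ := (hK.prod hK).exists_bound_of_continuousOn hGc
  obtain ⟨c, hc, hs⟩ := exists_laurent_series hρ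
    (fun x y h1 h2 h3 h4 => hG _ (hρU x y h1 h2 h3 h4))
    (fun x y h1 h2 h3 h4 => hM (x, y) ⟨(hKmem _).mpr ⟨h2, h1⟩, (hKmem _).mpr ⟨h4, h3⟩⟩)
  exact ⟨c, ρ⁻¹, M, by positivity, inv_lt_one_of_one_lt₀ hρ, hc, fun z => (hUG z).2 ▸ hs z⟩

end Laurent

/-! ### Fourier coefficients of powers of the Blaschke factor -/

section Blaschke

theorem one_sub_conj_mul_ne_zero {l z : ℂ} (h : ‖l‖ * ‖z‖ < 1) :
    1 - (starRingEnd ℂ) l * z ≠ 0 := by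
  intro h0
  have h1 : ‖(starRingEnd ℂ) l * z‖ = 1 := by rw [← sub_eq_zero.mp h0, norm_one]
  rw [norm_mul, Complex.norm_conj] at h1
  linarith

/-- This rests on the identity `|1 - l̄ z|² - |z - l|² = (1 - |l|²)(1 - |z|²)`. -/
theorem norm_blaschke_lt_one {l z : ℂ} (hl : ‖l‖ < 1) (hz : ‖z‖ < 1) :
    ‖(z - l) / (1 - (starRingEnd ℂ) l * z)‖ < 1 := by
  have hne : 1 - (starRingEnd ℂ) l * z ≠ 0 :=
    one_sub_conj_mul_ne_zero (by nlinarith [norm_nonneg l, norm_nonneg z])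
  rw [norm_div, div_lt_one (norm_pos_iff.mpr hne)]
  refine lt_of_pow_lt_pow_left₀ 2 (norm_nonneg _) ?_
  rw [← Complex.normSq_eq_norm_sq, ← Complex.normSq_eq_norm_sq]
  have h1 : Complex.normSq l < 1 := by
    rw [Complex.normSq_eq_norm_sq]
    nlinarith [norm_nonneg l]
  have h2 : Complex.normSq z < 1 := by
    rw [Complex.normSq_eq_norm_sq]
    nlinarith [norm_nonneg z]
  have h3 := mul_pos (sub_pos.mpr h1) (sub_pos.mpr h2)
  simp only [Complex.normSq_apply, Complex.sub_re, Complex.sub_im, Complex.mul_re, Complex.mul_im,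
    Complex.conj_re, Complex.conj_im, Complex.one_re, Complex.one_im] at h3 ⊢
  nlinarith

/-- The Taylor coefficients at `0` of the `m`-th power of the Blaschke factor. -/
def taylorCoeff (l : ℂ) (m j : ℕ) : ℂ :=
  (j.factorial : ℂ)⁻¹ *
    iteratedDeriv j (fun z => ((z - l) / (1 - (starRingEnd ℂ) l * z)) ^ m) 0

theorem differentiableOn_blaschke_pow {l : ℂ} {R : ℝ} (hR : ‖l‖ * R ≤ 1) (m : ℕ) :
    DifferentiableOn ℂ (fun z => ((z - l) / (1 - (starRingEnd ℂ) l * z)) ^ m)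
      (Metric.ball 0 R) := by
  intro z hz
  have hz' : ‖z‖ < R := by simpa using hz
  have hne : 1 - (starRingEnd ℂ) l * z ≠ 0 := by
    refine one_sub_conj_mul_ne_zero ?_
    rcases (norm_nonneg l).eq_or_lt with h | h
    · rw [← h]; simp
    · nlinarith
  have hd : DifferentiableAt ℂ (fun z => (z - l) / (1 - (starRingEnd ℂ) l * z)) z :=
    DifferentiableAt.div (by fun_prop) (by fun_prop) hne
  exact (hd.pow m).differentiableWithinAt

theorem hasSum_taylorCoeff {l : ℂ} (hl : ‖l‖ < 1) (m : ℕ) {z : ℂ} (hz : ‖z‖ ≤ 1) :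
    HasSum (fun j => taylorCoeff l m j * z ^ j)
      (((z - l) / (1 - (starRingEnd ℂ) l * z)) ^ m) := by
  have hR : ‖l‖ * (1 + (1 - ‖l‖) / 2) ≤ 1 := by nlinarith [norm_nonneg l]
  have h := Complex.hasSum_taylorSeries_on_ball (differentiableOn_blaschke_pow hR m)
    (z := z) (by rw [mem_ball_zero_iff]; linarith)
  simp only [sub_zero, smul_eq_mul] at h
  have he : (fun j => taylorCoeff l m j * z ^ j) = fun j => (j.factorial : ℂ)⁻¹ * (z ^ j *
      iteratedDeriv j (fun z => ((z - l) / (1 - (starRingEnd ℂ) l * z)) ^ m) 0) := by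
    ext j
    rw [taylorCoeff]
    ring
  rw [he]
  exact h

theorem summable_norm_taylorCoeff {l : ℂ} (hl : ‖l‖ < 1) (m : ℕ) :
    Summable fun j => ‖taylorCoeff l m j‖ := by
  simpa using (hasSum_taylorCoeff hl m (z := 1) (by simp)).summable.norm

theorem taylorCoeff_zero_right (l : ℂ) (m : ℕ) : taylorCoeff l m 0 = (-l) ^ m := by
  simp [taylorCoeff]

theorem taylorCoeff_zero_left (l : ℂ) (j : ℕ) : taylorCoeff l 0 j = if j = 0 then 1 else 0 := by
  by_cases hj : j = 0
  · simp [hj, taylorCoeff]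
  · simp [hj, taylorCoeff, iteratedDeriv_const]

/-- Cauchy's estimate on the circle of radius `r = √q`, where the Blaschke factor is bounded by some
`θ < 1`, gives coefficients at most `θ ^ m / r ^ j`. Multiplication by `q ^ j = r ^ (2 * j)` leaves
a geometric series in `r`, uniformly in `m`. -/
theorem exists_tsum_taylorCoeff_le {l : ℂ} (hl : ‖l‖ < 1) {q : ℝ} (hq : 0 < q) (hq1 : q < 1) :
    ∃ C θ : ℝ, 0 < C ∧ 0 < θ ∧ θ < 1 ∧ ∀ m, ∑' j, ‖taylorCoeff l m j‖ * q ^ j ≤ C * θ ^ m := by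
  set r := Real.sqrt q with hr
  have hr0 : 0 < r := Real.sqrt_pos.mpr hq
  have hr1 : r < 1 := by rw [hr, Real.sqrt_lt' one_pos]; simpa using hq1
  have hrr : r * r = q := Real.mul_self_sqrt hq.le
  have hne : ∀ z : ℂ, ‖z‖ < 1 → 1 - (starRingEnd ℂ) l * z ≠ 0 := fun z hz =>
    one_sub_conj_mul_ne_zero (by nlinarith [norm_nonneg l, norm_nonneg z])
  have hcont : ContinuousOn (fun z => ‖(z - l) / (1 - (starRingEnd ℂ) l * z)‖)
      (Metric.sphere 0 r) := by
    refine (ContinuousOn.div (by fun_prop) (by fun_prop) fun z hz => hne z ?_).norm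
    rw [mem_sphere_zero_iff_norm.mp hz]
    exact hr1
  obtain ⟨z₀, hz₀, hmax⟩ := (isCompact_sphere (0 : ℂ) r).exists_isMaxOn
    (NormedSpace.sphere_nonempty.mpr hr0.le) hcont
  -- The floor `1 / 2` only secures `0 < θ`.
  set θ := max ‖(z₀ - l) / (1 - (starRingEnd ℂ) l * z₀)‖ (1 / 2) with hθ
  have hθ1 : θ < 1 := max_lt (norm_blaschke_lt_one hl
    (by rw [mem_sphere_zero_iff_norm.mp hz₀]; exact hr1)) (by norm_num)
  have hθ0 : 0 < θ := lt_max_of_lt_right (by norm_num)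
  have hcoef : ∀ m j, ‖taylorCoeff l m j‖ ≤ θ ^ m / r ^ j := by
    intro m j
    have hd := differentiableOn_blaschke_pow (l := l) (R := 1) (by linarith) m
    have hcauchy := Complex.norm_iteratedDeriv_le_of_forall_mem_sphere_norm_le j hr0
      (C := θ ^ m) (f := fun z => ((z - l) / (1 - (starRingEnd ℂ) l * z)) ^ m) (c := 0)
      ((hd.mono (Metric.closedBall_subset_ball hr1)).diffContOnCl_ball Set.Subset.rfl)
      fun z hz => by
        rw [norm_pow]
        exact pow_le_pow_left₀ (norm_nonneg _) ((hmax hz).trans (le_max_left _ _)) m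
    rw [taylorCoeff, norm_mul, norm_inv, Complex.norm_natCast,
      inv_mul_le_iff₀ (by positivity)]
    rw [mul_div_assoc] at hcauchy
    exact hcauchy
  refine ⟨(1 - r)⁻¹, θ, inv_pos.mpr (by linarith), hθ0, hθ1, fun m => ?_⟩
  have hb : ∀ j, ‖taylorCoeff l m j‖ * q ^ j ≤ θ ^ m * r ^ j := fun j => by
    calc _ ≤ θ ^ m / r ^ j * q ^ j := by gcongr; exact hcoef m j
      _ = _ := by rw [← hrr, mul_pow]; field_simp
  have hg := (hasSum_geometric_of_lt_one hr0.le hr1).mul_left (θ ^ m)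
  calc _ ≤ ∑' j, θ ^ m * r ^ j :=
        (Summable.of_nonneg_of_le (fun _ => by positivity) hb hg.summable).tsum_le_tsum hb
          hg.summable
    _ = _ := by rw [hg.tsum_eq, mul_comm]

/-- The Fourier coefficients of the integer powers of the Blaschke factor. -/
def blaschkeCoeff (l : ℂ) (m j : ℤ) : ℂ :=
  if 0 ≤ m then if 0 ≤ j then taylorCoeff l m.toNat j.toNat else 0
  else if j ≤ 0 then (starRingEnd ℂ) (taylorCoeff l (-m).toNat (-j).toNat) else 0

theorem blaschkeCoeff_natCast (l : ℂ) (m j : ℕ) :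
    blaschkeCoeff l m j = taylorCoeff l m j := by simp [blaschkeCoeff]

theorem blaschkeCoeff_zero_left (l : ℂ) (j : ℤ) :
    blaschkeCoeff l 0 j = if j = 0 then 1 else 0 := by
  simp only [blaschkeCoeff, le_refl, if_true, Int.toNat_zero, taylorCoeff_zero_left]
  split_ifs <;> first | rfl | omega

theorem blaschkeCoeff_neg (l : ℂ) (m j : ℤ) :
    blaschkeCoeff l (-m) (-j) = (starRingEnd ℂ) (blaschkeCoeff l m j) := by
  rcases lt_trichotomy m 0 with h | rfl | h
  · have h1 : ¬ 0 ≤ m := by omega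
    have h2 : 0 ≤ -m := by omega
    simp only [blaschkeCoeff, h1, h2, if_true, if_false, Left.nonneg_neg_iff]
    split_ifs <;> simp
  · rw [neg_zero, blaschkeCoeff_zero_left, blaschkeCoeff_zero_left]
    split_ifs <;> first | omega | simp
  · have h1 : ¬ 0 ≤ -m := by omega
    simp only [blaschkeCoeff, h1, h.le, if_true, if_false, Left.neg_nonpos_iff, neg_neg]
    split_ifs <;> simp

theorem blaschkeCoeff_eq_zero {l : ℂ} {m j : ℤ} (hm : 0 ≤ m) (hj : j < 0) :
    blaschkeCoeff l m j = 0 := by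
  simp [blaschkeCoeff, hm, not_le.mpr hj]

theorem hasSum_nat_blaschkeCoeff_iff (l : ℂ) (m : ℕ) {E : Type*} [AddCommMonoid E]
    [TopologicalSpace E] {f : ℤ → ℂ → E} (hf : ∀ j, f j 0 = 0) {a : E} :
    HasSum (fun j : ℕ => f j (taylorCoeff l m j)) a ↔
      HasSum (fun j : ℤ => f j (blaschkeCoeff l m j)) a := by
  rw [← (Nat.cast_injective (R := ℤ)).hasSum_iff]
  · simp only [Function.comp_def, blaschkeCoeff_natCast]
  · intro j hj
    have hj0 : j < 0 := by
      by_contra h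
      exact hj ⟨j.toNat, by omega⟩
    rw [blaschkeCoeff_eq_zero (by positivity) hj0, hf]

theorem hasSum_blaschkeCoeff_neg_iff (l : ℂ) (m : ℤ) {E : Type*} [AddCommMonoid E]
    [TopologicalSpace E] {f : ℤ → ℂ → E} {a : E} :
    HasSum (fun j : ℤ => f j (blaschkeCoeff l (-m) j)) a ↔
      HasSum (fun j : ℤ => f (-j) ((starRingEnd ℂ) (blaschkeCoeff l m j))) a := by
  rw [← (Equiv.neg ℤ).hasSum_iff]
  simp only [Function.comp_def, Equiv.neg_apply, blaschkeCoeff_neg]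

theorem exists_nat_or_neg_of_forall {p : ℤ → Prop} (hnat : ∀ m : ℕ, p m)
    (hneg : ∀ m : ℕ, p m → p (-m)) (m : ℤ) : p m := by
  obtain ⟨k, rfl | rfl⟩ := m.eq_nat_or_neg
  · exact hnat k
  · exact hneg k (hnat k)

theorem summable_norm_blaschkeCoeff {l : ℂ} (hl : ‖l‖ < 1) (m : ℤ) :
    Summable fun j => ‖blaschkeCoeff l m j‖ := by
  induction m using exists_nat_or_neg_of_forall with
  | hnat m =>
    exact ((hasSum_nat_blaschkeCoeff_iff l m (f := fun _ x => ‖x‖) (by simp)).mp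
      (summable_norm_taylorCoeff hl m).hasSum).summable
  | hneg m ih =>
    refine ((hasSum_blaschkeCoeff_neg_iff l m (f := fun _ x => ‖x‖)
      (a := ∑' j, ‖blaschkeCoeff l m j‖)).mpr ?_).summable
    simpa only [Complex.norm_conj] using ih.hasSum

theorem exists_tsum_blaschkeCoeff_le {l : ℂ} (hl : ‖l‖ < 1) {q : ℝ} (hq : 0 < q) (hq1 : q < 1) :
    ∃ C θ : ℝ, 0 < C ∧ 0 < θ ∧ θ < 1 ∧
      ∀ m, ∑' j : ℤ, ‖blaschkeCoeff l m j‖ * q ^ j.natAbs ≤ C * θ ^ m.natAbs := by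
  obtain ⟨C, θ, hC, hθ, hθ1, h⟩ := exists_tsum_taylorCoeff_le hl hq hq1
  refine ⟨C, θ, hC, hθ, hθ1, fun m => ?_⟩
  have hs : ∀ m, Summable fun j : ℤ => ‖blaschkeCoeff l m j‖ * q ^ j.natAbs := fun m =>
    Summable.of_nonneg_of_le (fun _ => by positivity)
      (fun j => mul_le_of_le_one_right (norm_nonneg _) (pow_le_one₀ hq.le hq1.le))
      (summable_norm_blaschkeCoeff hl m)
  induction m using exists_nat_or_neg_of_forall with
  | hnat m =>
    have h1 := (hasSum_nat_blaschkeCoeff_iff l m (f := fun j x => ‖x‖ * q ^ j.natAbs)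
      (by simp)).mpr (hs m).hasSum
    rw [← h1.tsum_eq]
    simpa using h m
  | hneg m ih =>
    rw [((hasSum_blaschkeCoeff_neg_iff l m (f := fun j x => ‖x‖ * q ^ j.natAbs)).mpr
      (by simpa only [Complex.norm_conj, Int.natAbs_neg] using (hs m).hasSum)).tsum_eq,
      Int.natAbs_neg]
    exact ih

theorem hasSum_blaschkeCoeff {l : ℂ} (hl : ‖l‖ < 1) (m : ℤ) (z : Circle) :
    HasSum (fun j => blaschkeCoeff l m j * (z : ℂ) ^ j) ((blaschke l hl z : ℂ) ^ m) := by
  induction m using exists_nat_or_neg_of_forall with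
  | hnat m =>
    refine (hasSum_nat_blaschkeCoeff_iff l m (f := fun j x => x * (z : ℂ) ^ j) (by simp)).mp ?_
    simp only [zpow_natCast]
    exact hasSum_taylorCoeff hl m (Circle.norm_coe z).le
  | hneg m ih =>
    refine (hasSum_blaschkeCoeff_neg_iff l m (f := fun j x => x * (z : ℂ) ^ j)).mpr ?_
    have h := ih.map (starRingEnd ℂ) Complex.continuous_conj
    simp only [Function.comp_def, map_mul, map_zpow₀, ← Circle.coe_inv_eq_conj, Circle.coe_inv,
      inv_zpow'] at h
    exact h

end Blaschke

/-! ### The matrix on characters and its anisotropic weights -/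

section Weights

/-- The coefficient of the character `n'` in the composition of the character `n` with `T`. -/
def koopmanMatrix (l : ℂ) (n n' : ℤ × ℤ) : ℂ :=
  if n'.2 = n.1 + n.2 then blaschkeCoeff l (n.1 + n.2) (n'.1 - n.1) else 0

theorem hasSum_koopmanMatrix_iff (l : ℂ) (n : ℤ × ℤ) {E : Type*} [AddCommMonoid E]
    [TopologicalSpace E] {f : ℤ × ℤ → ℂ → E} (hf : ∀ n', f n' 0 = 0) {a : E} :
    HasSum (fun n' => f n' (koopmanMatrix l n n')) a ↔
      HasSum (fun j : ℤ => f (n.1 + j, n.1 + n.2) (blaschkeCoeff l (n.1 + n.2) j)) a := by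
  have hinj : Function.Injective fun j : ℤ => (n.1 + j, n.1 + n.2) := fun i j h => by
    simpa using h
  rw [← hinj.hasSum_iff]
  · simp [Function.comp_def, koopmanMatrix]
  · rintro ⟨a, b⟩ hn
    have : ¬ b = n.1 + n.2 := by
      rintro rfl
      exact hn ⟨a - n.1, by simp⟩
    simp [koopmanMatrix, this, hf]

/-- The coordinates of `n` have opposite signs: the stable cone. -/
def OppositeSigns (n : ℤ × ℤ) : Prop := (0 < n.1 ∧ n.2 < 0) ∨ (n.1 < 0 ∧ 0 < n.2)

instance (n : ℤ × ℤ) : Decidable (OppositeSigns n) := by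
  unfold OppositeSigns
  infer_instance

/-- The only information about the support that the combinatorial arguments use. When `n.1 + n.2 =
0` both implications apply and force `n'.1 = n.1`. -/
theorem koopmanMatrix_ne_zero {l : ℂ} {n n' : ℤ × ℤ} (h : koopmanMatrix l n n' ≠ 0) :
    n'.2 = n.1 + n.2 ∧ (0 ≤ n.1 + n.2 → n.1 ≤ n'.1) ∧ (n.1 + n.2 ≤ 0 → n'.1 ≤ n.1) := by
  have h2 : n'.2 = n.1 + n.2 := by
    by_contra h2
    exact h (by simp [koopmanMatrix, h2])
  rw [koopmanMatrix, if_pos h2] at h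
  refine ⟨h2, fun hm => ?_, fun hm => ?_⟩
  · by_contra hlt
    exact h (blaschkeCoeff_eq_zero hm (by omega))
  · by_contra hlt
    have := blaschkeCoeff_neg l (-(n.1 + n.2)) (-(n'.1 - n.1))
    rw [neg_neg, neg_neg, blaschkeCoeff_eq_zero (m := -(n.1 + n.2)) (j := -(n'.1 - n.1))
      (by omega) (by omega), map_zero] at this
    exact h this

theorem koopmanMatrix_self (l : ℂ) {n : ℤ × ℤ} (hn : n.1 = 0) :
    koopmanMatrix l n n = blaschkeCoeff l n.2 0 := by
  simp [koopmanMatrix, hn]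

/-- The exponent of the anisotropic weight. -/
def weightExp (n : ℤ × ℤ) : ℤ :=
  if OppositeSigns n then -(n.1.natAbs + n.2.natAbs) else n.1.natAbs

/-- A shift of the first coordinate in the direction of the sign of `m` leads out of the stable cone
or further into the unstable one, so the exponent gains at least `|j|`. This gain supplies the
factor `q ^ |j|` that makes the Blaschke row sums decay in `m`. -/
theorem le_weightExp_add {a m j : ℤ} (h1 : 0 ≤ m → 0 ≤ j) (h2 : m ≤ 0 → j ≤ 0) :
    j.natAbs + weightExp (a, m) ≤ weightExp (a + j, m) := by
  simp only [weightExp, OppositeSigns]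
  split_ifs <;> omega

theorem weightExp_le (n : ℤ × ℤ) : weightExp n ≤ weightExp (n.1, n.1 + n.2) := by
  simp only [weightExp, OppositeSigns]
  split_ifs <;> omega

/-- Every large `n` is controlled by one of two gains: the shear `n₂ ↦ n₁ + n₂` raises the exponent,
or `|n₁ + n₂|` is large and the factor `θ ^ |n₁ + n₂|` is small. -/
theorem max_le_weightExp_sub (n : ℤ × ℤ) : (max n.1.natAbs n.2.natAbs : ℤ) ≤
    weightExp (n.1, n.1 + n.2) - weightExp n + (n.1 + n.2).natAbs := by
  simp only [weightExp, OppositeSigns]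
  split_ifs <;> omega

theorem summable_koopmanMatrix_of_le {l : ℂ} (hl : ‖l‖ < 1) (n : ℤ × ℤ) {w : ℤ × ℤ → ℝ}
    (hw0 : ∀ n', 0 ≤ w n') {C : ℝ} (hw : ∀ n', koopmanMatrix l n n' ≠ 0 → w n' ≤ C) :
    Summable fun n' => ‖koopmanMatrix l n n'‖ * w n' := by
  have hM : Summable fun n' => ‖koopmanMatrix l n n'‖ :=
    ((hasSum_koopmanMatrix_iff l n (f := fun _ x => ‖x‖) (by simp)).mpr
      (summable_norm_blaschkeCoeff hl (n.1 + n.2)).hasSum).summable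
  refine Summable.of_nonneg_of_le (fun n' => mul_nonneg (norm_nonneg _) (hw0 n')) (fun n' => ?_)
    (hM.mul_right C)
  by_cases h : koopmanMatrix l n n' = 0
  · simp [h]
  · exact mul_le_mul_of_nonneg_left (hw n' h) (norm_nonneg _)

theorem weight_le {l : ℂ} {q : ℝ} (hq : 0 < q) (hq1 : q < 1) {n n' : ℤ × ℤ}
    (h : koopmanMatrix l n n' ≠ 0) : q ^ weightExp n' ≤
      q ^ (n'.1 - n.1).natAbs * q ^ weightExp (n.1, n.1 + n.2) := by
  obtain ⟨h1, h2, h3⟩ := koopmanMatrix_ne_zero h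
  have h4 := le_weightExp_add (a := n.1) (m := n.1 + n.2) (j := n'.1 - n.1)
    (fun h => sub_nonneg.mpr (h2 h)) (fun h => sub_nonpos.mpr (h3 h))
  have h5 : (n.1 + (n'.1 - n.1), n.1 + n.2) = n' := by ext <;> simp [h1]
  rw [h5] at h4
  rw [← zpow_natCast, ← zpow_add₀ hq.ne']
  exact zpow_le_zpow_right_of_le_one₀ hq hq1.le h4

theorem summable_koopmanMatrix_weight {l : ℂ} (hl : ‖l‖ < 1) {q : ℝ} (hq : 0 < q) (hq1 : q < 1)
    (n : ℤ × ℤ) : Summable fun n' => ‖koopmanMatrix l n n'‖ * q ^ weightExp n' :=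
  summable_koopmanMatrix_of_le hl n (fun _ => by positivity)
    (C := q ^ weightExp (n.1, n.1 + n.2)) fun _ h => (weight_le hq hq1 h).trans
      (mul_le_of_le_one_left (by positivity) (pow_le_one₀ hq.le hq1.le))

/-- The factor `γ ^ max` is a compactness statement: relative to the weight, all but finitely many
rows are arbitrarily small. -/
theorem exists_tsum_koopmanMatrix_le {l : ℂ} (hl : ‖l‖ < 1) {q : ℝ} (hq : 0 < q) (hq1 : q < 1) :
    ∃ C γ : ℝ, 0 < C ∧ 0 < γ ∧ γ < 1 ∧ ∀ n : ℤ × ℤ,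
      ∑' n', ‖koopmanMatrix l n n'‖ * q ^ weightExp n' ≤
        C * γ ^ (max n.1.natAbs n.2.natAbs) * q ^ weightExp n := by
  obtain ⟨C, θ, hC, hθ, hθ1, hB⟩ := exists_tsum_blaschkeCoeff_le hl hq hq1
  refine ⟨C, max q θ, hC, lt_max_of_lt_left hq, max_lt hq1 hθ1, fun n => ?_⟩
  set γ := max q θ
  have hγ : 0 < γ := lt_max_of_lt_left hq
  have hγ1 : γ < 1 := max_lt hq1 hθ1
  set κ := weightExp (n.1, n.1 + n.2)
  have hs : Summable fun j : ℤ => ‖blaschkeCoeff l (n.1 + n.2) j‖ * q ^ j.natAbs :=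
    Summable.of_nonneg_of_le (fun _ => by positivity)
      (fun j => mul_le_of_le_one_right (norm_nonneg _) (pow_le_one₀ hq.le hq1.le))
      (summable_norm_blaschkeCoeff hl _)
  have hsum := (hasSum_koopmanMatrix_iff l n
    (f := fun n' x => ‖x‖ * (q ^ (n'.1 - n.1).natAbs * q ^ κ)) (by simp)).mpr
    (by simpa only [add_sub_cancel_left, mul_assoc] using hs.hasSum.mul_right (q ^ κ))
  obtain ⟨d, hd⟩ := Int.eq_ofNat_of_zero_le (sub_nonneg.mpr (weightExp_le n))
  have hmax : max n.1.natAbs n.2.natAbs ≤ d + (n.1 + n.2).natAbs := by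
    have := max_le_weightExp_sub n
    omega
  calc _ ≤ ∑' n', ‖koopmanMatrix l n n'‖ * (q ^ (n'.1 - n.1).natAbs * q ^ κ) := by
        refine (summable_koopmanMatrix_weight hl hq hq1 n).tsum_le_tsum (fun n' => ?_)
          hsum.summable
        by_cases h : koopmanMatrix l n n' = 0
        · simp [h]
        · exact mul_le_mul_of_nonneg_left (weight_le hq hq1 h) (norm_nonneg _)
    _ = (∑' j : ℤ, ‖blaschkeCoeff l (n.1 + n.2) j‖ * q ^ j.natAbs) * q ^ κ := hsum.tsum_eq
    _ ≤ C * θ ^ (n.1 + n.2).natAbs * q ^ κ := by gcongr; exact hB _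
    _ = C * (q ^ d * θ ^ (n.1 + n.2).natAbs) * q ^ weightExp n := by
        have : κ = weightExp n + d := by omega
        rw [this, zpow_add₀ hq.ne', zpow_natCast]
        ring
    _ ≤ C * (γ ^ d * γ ^ (n.1 + n.2).natAbs) * q ^ weightExp n := by
        gcongr
        · exact le_max_left _ _
        · exact le_max_right _ _
    _ ≤ C * γ ^ (max n.1.natAbs n.2.natAbs) * q ^ weightExp n := by
        rw [← pow_add]
        gcongr C * ?_ * _
        exact pow_le_pow_of_le_one hγ.le hγ1.le hmax

/-- A bounded height that does not increase along the non-zero entries of the matrix, and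
decreases along those that start at a small `n` and are not loops. -/
def height (R : ℕ) (n : ℤ × ℤ) : ℕ :=
  if OppositeSigns n then R + 2 + min n.2.natAbs R
  else if n.1 = 0 then R + 1 else R - n.2.natAbs

theorem height_le {l : ℂ} (R : ℕ) {n n' : ℤ × ℤ} (h : koopmanMatrix l n n' ≠ 0) (hn : n ≠ 0) :
    height R n' ≤ height R n := by
  obtain ⟨h1, h2, h3⟩ := koopmanMatrix_ne_zero h
  have hn0 : ¬ (n.1 = 0 ∧ n.2 = 0) := fun h => hn (Prod.ext h.1 h.2)
  rw [height, height]
  split_ifs <;> simp only [OppositeSigns] at * <;> omega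

/-- Paths run from the stable cone, where `|n₂|` drops, possibly through the axis, into the unstable
cone, where `|n₂|` grows. The truncation at `R` keeps the height bounded, and `|n₂| < R` ensures
that the drop is seen. -/
theorem height_lt {l : ℂ} {R : ℕ} {n n' : ℤ × ℤ} (h : koopmanMatrix l n n' ≠ 0) (hn : n ≠ 0)
    (hne : n' ≠ n) (hR : n.2.natAbs < R) : height R n' < height R n := by
  obtain ⟨h1, h2, h3⟩ := koopmanMatrix_ne_zero h
  have hn0 : ¬ (n.1 = 0 ∧ n.2 = 0) := fun h => hn (Prod.ext h.1 h.2)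
  have hne' : ¬ (n'.1 = n.1 ∧ n'.2 = n.2) := fun h => hne (Prod.ext h.1 h.2)
  rw [height, height]
  split_ifs <;> simp only [OppositeSigns] at * <;> omega

theorem height_bound (R : ℕ) (n : ℤ × ℤ) : height R n ≤ 2 * R + 2 := by
  simp only [height]
  split_ifs <;> omega

/-- The weight is `A ^ height * q ^ weightExp`. Rows with large `n` are small already without the
height; in the remaining rows every non-loop entry lowers the height and gains a factor `A⁻¹`, which
beats the constant `C`. Boundedness of the height keeps the two-sided comparison with powers of `q`.
-/
theorem exists_weight {l : ℂ} (hl : ‖l‖ < 1) {q : ℝ} (hq : 0 < q) (hq1 : q < 1) {ε : ℝ}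
    (hε : 0 < ε) : ∃ (v : ℤ × ℤ → ℝ) (K : ℝ) (R : ℕ), (∀ n, 0 < v n) ∧
      (∀ n, q ^ (n.1.natAbs + n.2.natAbs) ≤ v n) ∧
      (∀ n, v n ≤ K * (q ^ (n.1.natAbs + n.2.natAbs))⁻¹) ∧
      (∀ n, Summable fun n' => ‖koopmanMatrix l n n'‖ * v n') ∧
      ∀ n ≠ 0, ∑' n', (if n' = n ∧ n.2.natAbs < R then 0 else ‖koopmanMatrix l n n'‖ * v n') ≤
        ε * v n := by
  obtain ⟨C, γ, hC, hγ, hγ1, hM⟩ := exists_tsum_koopmanMatrix_le hl hq hq1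
  obtain ⟨R, hR⟩ := exists_pow_lt_of_lt_one (div_pos hε hC) hγ1
  -- `C / ε` lets one step of height absorb the row constant; the `1` makes powers of `A` monotone.
  set A := max 1 (C / ε) with hA
  have hA1 : 1 ≤ A := le_max_left _ _
  have hA0 : 0 < A := one_pos.trans_le hA1
  have hAC : C ≤ ε * A := by
    rw [mul_comm, ← div_le_iff₀ hε]
    exact le_max_right _ _
  have hle : ∀ n : ℤ × ℤ, A ^ height R n * q ^ weightExp n ≤
      A ^ (2 * R + 2) * (q ^ (n.1.natAbs + n.2.natAbs))⁻¹ := fun n => by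
    have h1 : -((n.1.natAbs + n.2.natAbs : ℕ) : ℤ) ≤ weightExp n := by
      simp only [weightExp]
      split_ifs <;> omega
    rw [← zpow_natCast q, ← zpow_neg]
    exact mul_le_mul (pow_le_pow_right₀ hA1 (height_bound R n))
      (zpow_le_zpow_right_of_le_one₀ hq hq1.le h1) (by positivity) (by positivity)
  have hs := summable_koopmanMatrix_weight hl hq hq1
  have hsv : ∀ n, Summable fun n' =>
      ‖koopmanMatrix l n n'‖ * (A ^ height R n' * q ^ weightExp n') := fun n =>
    Summable.of_nonneg_of_le (fun _ => by positivity) (fun n' => by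
      rw [mul_left_comm]
      exact mul_le_mul_of_nonneg_right (pow_le_pow_right₀ hA1 (height_bound R n'))
        (by positivity)) ((hs n).mul_left (A ^ (2 * R + 2)))
  refine ⟨fun n => A ^ height R n * q ^ weightExp n, A ^ (2 * R + 2), R, fun n => by positivity,
    fun n => ?_, hle, hsv, fun n hn => ?_⟩
  · have h1 : weightExp n ≤ ((n.1.natAbs + n.2.natAbs : ℕ) : ℤ) := by
      simp only [weightExp]
      split_ifs <;> omega
    rw [← zpow_natCast q]
    calc q ^ ((n.1.natAbs + n.2.natAbs : ℕ) : ℤ) ≤ q ^ weightExp n :=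
          zpow_le_zpow_right_of_le_one₀ hq hq1.le h1
      _ ≤ _ := le_mul_of_one_le_left (by positivity) (one_le_pow₀ hA1)
  · have hrow : ∀ B : ℝ, 0 ≤ B → (∀ n', koopmanMatrix l n n' ≠ 0 → ¬(n' = n ∧ n.2.natAbs < R) →
        A ^ height R n' ≤ B) → ∑' n', (if n' = n ∧ n.2.natAbs < R then 0 else
          ‖koopmanMatrix l n n'‖ * (A ^ height R n' * q ^ weightExp n')) ≤
        B * (C * γ ^ (max n.1.natAbs n.2.natAbs) * q ^ weightExp n) := fun B hB0 hB => by
      have hpt : ∀ n', (if n' = n ∧ n.2.natAbs < R then 0 else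
          ‖koopmanMatrix l n n'‖ * (A ^ height R n' * q ^ weightExp n')) ≤
          B * (‖koopmanMatrix l n n'‖ * q ^ weightExp n') := fun n' => by
        split_ifs with h
        · positivity
        · by_cases h0 : koopmanMatrix l n n' = 0
          · simp [h0]
          · rw [mul_left_comm]
            exact mul_le_mul_of_nonneg_right (hB n' h0 h) (by positivity)
      have hsB := (hs n).mul_left B
      refine (Summable.tsum_le_tsum hpt (Summable.of_nonneg_of_le (fun n' => ?_) hpt hsB)
        hsB).trans ?_
      · split_ifs <;> positivity
      · rw [tsum_mul_left]
        exact mul_le_mul_of_nonneg_left (hM n) hB0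
    by_cases hbig : R ≤ max n.1.natAbs n.2.natAbs
    · refine (hrow (A ^ height R n) (by positivity) fun n' h _ =>
        pow_le_pow_right₀ hA1 (height_le R h hn)).trans ?_
      have h1 : C * γ ^ (max n.1.natAbs n.2.natAbs) ≤ ε := by
        rw [mul_comm, ← le_div_iff₀ hC]
        exact (pow_le_pow_of_le_one hγ.le hγ1.le hbig).trans hR.le
      calc _ ≤ A ^ height R n * (ε * q ^ weightExp n) := by gcongr
        _ = _ := by ring
    · have hsmall : n.2.natAbs < R := (le_max_right _ _).trans_lt (not_le.mp hbig)
      refine (hrow (A ^ height R n / A) (by positivity) fun n' h hloop => ?_).trans ?_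
      · have := height_lt h hn (fun h => hloop ⟨h, hsmall⟩) hsmall
        rw [le_div_iff₀ hA0, ← pow_succ]
        exact pow_le_pow_right₀ hA1 this
      · have h1 : C * γ ^ (max n.1.natAbs n.2.natAbs) ≤ ε * A :=
          (mul_le_of_le_one_right hC.le (pow_le_one₀ hγ.le hγ1.le)).trans hAC
        calc _ ≤ A ^ height R n / A * (ε * A * q ^ weightExp n) := by gcongr
          _ = _ := by field_simp

end Weights

/-! ### Characters, Haar integration and the recursion for correlations -/

section Dynamics

/-- The characters of the torus. -/
def torusChar (n : ℤ × ℤ) (z : Torus) : ℂ := (z.1 : ℂ) ^ n.1 * (z.2 : ℂ) ^ n.2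

theorem norm_torusChar (n : ℤ × ℤ) (z : Torus) : ‖torusChar n z‖ = 1 := by
  simp [torusChar, Circle.norm_coe]

theorem torusChar_zero (z : Torus) : torusChar 0 z = 1 := by simp [torusChar]

theorem torusChar_add (n m : ℤ × ℤ) (z : Torus) :
    torusChar (n + m) z = torusChar n z * torusChar m z := by
  simp only [torusChar, Prod.fst_add, Prod.snd_add, zpow_add₀ (Circle.coe_ne_zero _)]
  ring

theorem torusChar_mul (n : ℤ × ℤ) (w z : Torus) :
    torusChar n (w * z) = torusChar n w * torusChar n z := by
  simp only [torusChar, Prod.fst_mul, Prod.snd_mul, Circle.coe_mul, mul_zpow]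
  ring

theorem continuous_torusChar (n : ℤ × ℤ) : Continuous (torusChar n) := by
  refine Continuous.mul ?_ ?_
  · exact (by fun_prop : Continuous fun z : Torus => (z.1 : ℂ)).zpow₀ _ fun _ =>
      Or.inl (Circle.coe_ne_zero _)
  · exact (by fun_prop : Continuous fun z : Torus => (z.2 : ℂ)).zpow₀ _ fun _ =>
      Or.inl (Circle.coe_ne_zero _)

theorem analyticNearTorus_torusChar (n : ℤ × ℤ) : AnalyticNearTorus (torusChar n) := by
  refine ⟨{p | p.1 ≠ 0 ∧ p.2 ≠ 0}, fun p => p.1 ^ n.1 * p.2 ^ n.2, ?_, ?_, fun z => ⟨?_, rfl⟩⟩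
  · exact (isOpen_ne.preimage continuous_fst).inter (isOpen_ne.preimage continuous_snd)
  · intro p hp
    exact (analyticAt_fst.zpow hp.1).mul (analyticAt_snd.zpow hp.2)
  · exact ⟨Circle.coe_ne_zero _, Circle.coe_ne_zero _⟩

theorem AnalyticNearTorus.continuous {g : Torus → ℂ} (hg : AnalyticNearTorus g) :
    Continuous g := by
  obtain ⟨U, G, -, hG, hUG⟩ := hg
  refine continuous_iff_continuousAt.mpr fun z => ?_
  have he : g = fun z : Torus => G ((z.1 : ℂ), (z.2 : ℂ)) := funext fun z => ((hUG z).2).symm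
  rw [he]
  exact ContinuousAt.comp (f := fun z : Torus => ((z.1 : ℂ), (z.2 : ℂ)))
    (hG _ (hUG z).1).continuousAt (by fun_prop)

theorem exists_torusChar_ne_one {n : ℤ × ℤ} (hn : n ≠ 0) : ∃ w, torusChar n w ≠ 1 := by
  -- The `m`-th power of `exp(iπ / m)` is `-1`.
  have key : ∀ m : ℤ, m ≠ 0 → ((Circle.exp (Real.pi / m) : Circle) : ℂ) ^ m ≠ 1 := fun m hm => by
    have hm' : (m : ℝ) ≠ 0 := Int.cast_ne_zero.mpr hm
    rw [← Circle.coe_zpow, ← Circle.exp_intCast_mul, mul_div_cancel₀ _ hm', Circle.coe_exp,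
      Complex.exp_pi_mul_I]
    norm_num
  by_cases h : n.1 = 0
  · have h2 : n.2 ≠ 0 := fun h2 => hn (Prod.ext h h2)
    exact ⟨(1, Circle.exp (Real.pi / n.2)), by simpa [torusChar] using key _ h2⟩
  · exact ⟨(Circle.exp (Real.pi / n.1), 1), by simpa [torusChar] using key _ h⟩

instance : IsProbabilityMeasure haar := ⟨Measure.haarMeasure_self⟩

instance : haar.IsMulLeftInvariant := inferInstanceAs (Measure.haarMeasure ⊤).IsMulLeftInvariant

theorem integral_torusChar (n : ℤ × ℤ) : ∫ z, torusChar n z ∂haar = if n = 0 then 1 else 0 := by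
  split_ifs with hn
  · subst hn
    simp [torusChar_zero]
  · obtain ⟨w, hw⟩ := exists_torusChar_ne_one hn
    have h := integral_mul_left_eq_self (μ := haar) (torusChar n) w
    simp only [torusChar_mul, integral_const_mul] at h
    have h2 : (torusChar n w - 1) * ∫ z, torusChar n z ∂haar = 0 := by linear_combination h
    exact (mul_eq_zero.mp h2).resolve_left (sub_ne_zero.mpr hw)

theorem integrable_of_continuous {f : Torus → ℂ} (hf : Continuous f) : Integrable f haar := by
  obtain ⟨C, hC⟩ := isCompact_univ.exists_bound_of_continuousOn hf.continuousOn
  exact Integrable.of_bound hf.aestronglyMeasurable C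
    (Eventually.of_forall fun z => hC z (Set.mem_univ z))

theorem norm_integral_le {f : Torus → ℂ} {C : ℝ} (hf : ∀ z, ‖f z‖ ≤ C) :
    ‖∫ z, f z ∂haar‖ ≤ C := by
  simpa using norm_integral_le_of_norm_le_const (μ := haar) (Eventually.of_forall hf)

/-- Termwise integration of a series with summable coefficients. -/
theorem hasSum_integral_mul_series {g : Torus → ℂ} (hg : Continuous g) {c : ℤ × ℤ → ℂ}
    (hc : Summable fun n => ‖c n‖) {u : ℤ × ℤ → Torus → ℂ} (hu : ∀ n, Continuous (u n))
    (hu1 : ∀ n z, ‖u n z‖ ≤ 1) {f : Torus → ℂ} (hf : ∀ z, HasSum (fun n => c n * u n z) (f z)) :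
    HasSum (fun n => c n * ∫ z, g z * u n z ∂haar) (∫ z, g z * f z ∂haar) := by
  obtain ⟨C, hC⟩ := isCompact_univ.exists_bound_of_continuousOn hg.continuousOn
  have hint : ∀ n, Continuous fun z => g z * (c n * u n z) := fun n =>
    hg.mul (continuous_const.mul (hu n))
  have hle : ∀ n z, ‖g z * (c n * u n z)‖ ≤ C * ‖c n‖ := fun n z => by
    rw [norm_mul, norm_mul]
    exact mul_le_mul (hC z (Set.mem_univ z)) (mul_le_of_le_one_right (norm_nonneg _) (hu1 n z))
      (by positivity) ((norm_nonneg _).trans (hC z (Set.mem_univ z)))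
  have h := hasSum_integral_of_summable_integral_norm (μ := haar)
    (F := fun n z => g z * (c n * u n z)) (fun n => integrable_of_continuous (hint n)) ?_
  · have h1 : (fun n => ∫ z, g z * (c n * u n z) ∂haar) =
        fun n => c n * ∫ z, g z * u n z ∂haar := by
      ext n
      rw [← integral_const_mul]
      congr 1
      ext z
      ring
    have h2 : ∫ z, ∑' n, g z * (c n * u n z) ∂haar = ∫ z, g z * f z ∂haar := by
      congr 1
      ext z
      exact ((hf z).mul_left (g z)).tsum_eq
    rwa [h1, h2] at h
  · refine Summable.of_nonneg_of_le (fun n => integral_nonneg fun z => norm_nonneg _)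
      (fun n => ?_) (hc.mul_left C)
    have h3 := norm_integral_le_of_norm_le_const (μ := haar) (f := fun z => ‖g z * (c n * u n z)‖)
      (C := C * ‖c n‖) (Eventually.of_forall fun z => by rw [norm_norm]; exact hle n z)
    rw [Real.norm_of_nonneg (integral_nonneg fun z => norm_nonneg _)] at h3
    simpa using h3

theorem summable_pow_natAbs {q : ℝ} (hq : 0 < q) (hq1 : q < 1) :
    Summable fun n : ℤ × ℤ => q ^ (n.1.natAbs + n.2.natAbs) := by
  have hgeom : Summable fun n : ℤ => q ^ n.natAbs := by
    refine Summable.of_nat_of_neg ?_ ?_ <;>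
    simpa using summable_geometric_of_lt_one hq.le hq1
  simp only [pow_add]
  exact hgeom.mul_of_nonneg hgeom (fun _ => by positivity) (fun _ => by positivity)

variable {l : ℂ} (hl : ‖l‖ < 1)

theorem continuous_T : Continuous (T l hl) := by
  have hb : Continuous (blaschke l hl) := by
    refine Continuous.subtype_mk (f := fun z : Circle =>
      ((z : ℂ) - l) / (1 - (starRingEnd ℂ) l * z)) ?_ _
    refine Continuous.div (by fun_prop) (by fun_prop) fun z => ?_
    exact one_sub_conj_mul_ne_zero (by rw [Circle.norm_coe, mul_one]; exact hl)
  unfold T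
  fun_prop

theorem hasSum_torusChar_T (n : ℤ × ℤ) (z : Torus) :
    HasSum (fun n' => koopmanMatrix l n n' * torusChar n' z) (torusChar n (T l hl z)) := by
  refine (hasSum_koopmanMatrix_iff l n (f := fun n' x => x * torusChar n' z) (by simp)).mpr ?_
  have h := (hasSum_blaschkeCoeff hl (n.1 + n.2) z.1).mul_left
    ((z.1 : ℂ) ^ n.1 * (z.2 : ℂ) ^ (n.1 + n.2))
  have h1 : torusChar n (T l hl z) = (z.1 : ℂ) ^ n.1 * (z.2 : ℂ) ^ (n.1 + n.2) *
      (blaschke l hl z.1 : ℂ) ^ (n.1 + n.2) := by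
    simp only [torusChar, T, Circle.coe_mul, mul_zpow, zpow_add₀ (Circle.coe_ne_zero _)]
    ring
  have h2 : (fun j : ℤ => blaschkeCoeff l (n.1 + n.2) j * torusChar (n.1 + j, n.1 + n.2) z) =
      fun j => (z.1 : ℂ) ^ n.1 * (z.2 : ℂ) ^ (n.1 + n.2) *
        (blaschkeCoeff l (n.1 + n.2) j * (z.1 : ℂ) ^ j) := by
    ext j
    simp only [torusChar, zpow_add₀ (Circle.coe_ne_zero _)]
    ring
  rw [h1, h2]
  exact h

/-- Correlation of `g` with the composition of a character with `T^k`. -/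
def charCorrelation (g : Torus → ℂ) (k : ℕ) (n : ℤ × ℤ) : ℂ :=
  ∫ z, g z * torusChar n ((T l hl)^[k] z) ∂haar

theorem hasSum_charCorrelation {g : Torus → ℂ} (hg : Continuous g) {c : ℤ × ℤ → ℂ}
    (hc : Summable fun n => ‖c n‖) {f : Torus → ℂ}
    (hf : ∀ z, HasSum (fun n => c n * torusChar n z) (f z)) (k : ℕ) :
    HasSum (fun n => c n * charCorrelation hl g k n)
      (∫ z, g z * f ((T l hl)^[k] z) ∂haar) :=
  hasSum_integral_mul_series hg hc (u := fun n z => torusChar n ((T l hl)^[k] z))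
    (fun n => (continuous_torusChar n).comp ((continuous_T hl).iterate k))
    (fun n _ => (norm_torusChar n _).le) (fun _ => hf _)

theorem summable_norm_koopmanMatrix {l : ℂ} (hl : ‖l‖ < 1) (n : ℤ × ℤ) :
    Summable fun n' => ‖koopmanMatrix l n n'‖ := by
  simpa using summable_koopmanMatrix_of_le hl n (w := fun _ => 1) (C := 1) (by simp) (by simp)

theorem hasSum_charCorrelation_succ {g : Torus → ℂ} (hg : Continuous g) (k : ℕ) (n : ℤ × ℤ) :
    HasSum (fun n' => koopmanMatrix l n n' * charCorrelation hl g k n')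
      (charCorrelation hl g (k + 1) n) := by
  simp only [charCorrelation, Function.iterate_succ_apply']
  exact hasSum_charCorrelation hl hg (summable_norm_koopmanMatrix hl n)
    (fun z => hasSum_torusChar_T hl n z) k

theorem correlation_bounded {g h : Torus → ℂ} (hg : Continuous g) (hh : Continuous h) :
    ∃ C, ∀ k, ‖correlation l hl g h k‖ ≤ C := by
  obtain ⟨A, hA⟩ := isCompact_univ.exists_bound_of_continuousOn hg.continuousOn
  obtain ⟨B, hB⟩ := isCompact_univ.exists_bound_of_continuousOn hh.continuousOn
  have hA0 : 0 ≤ A := (norm_nonneg _).trans (hA 1 (Set.mem_univ _))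
  refine ⟨A * B + ‖(∫ z, g z ∂haar) * ∫ z, h z ∂haar‖, fun k => ?_⟩
  refine (norm_sub_le _ _).trans (add_le_add_left (norm_integral_le fun z => ?_) _)
  rw [norm_mul]
  exact mul_le_mul (hA z (Set.mem_univ _)) (hB _ (Set.mem_univ _)) (norm_nonneg _) hA0

end Dynamics

/-! ### Loop entries and the invariant unstable cone -/

section Resonances

theorem norm_lt_one_of_mem_resonances {l : ℂ} (hl : ‖l‖ < 1) {w : ℂ} (hw : w ∈ resonances l) :
    ‖w‖ < 1 := by
  rcases hw with ⟨n, hn, rfl⟩ | ⟨n, hn, rfl⟩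
  · rw [norm_pow, norm_neg]
    exact pow_lt_one₀ (norm_nonneg _) hl (by omega)
  · rw [norm_pow, norm_neg, Complex.norm_conj]
    exact pow_lt_one₀ (norm_nonneg _) hl (by omega)

theorem finite_resonances {l : ℂ} (hl : ‖l‖ < 1) {ε : ℝ} (hε : 0 < ε) :
    {w ∈ resonances l | ε ≤ ‖w‖}.Finite := by
  obtain ⟨N, hN⟩ := exists_pow_lt_of_lt_one hε hl
  refine (((Finset.range N).finite_toSet.image fun n => (-l) ^ n).union
    ((Finset.range N).finite_toSet.image fun n => (-(starRingEnd ℂ) l) ^ n)).subset ?_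
  have key : ∀ n, ε ≤ ‖l‖ ^ n → n < N := fun n h => by
    by_contra hlt
    exact absurd (pow_le_pow_of_le_one (norm_nonneg _) hl.le (not_lt.mp hlt)) (by linarith)
  rintro w ⟨⟨n, hn, rfl⟩ | ⟨n, hn, rfl⟩, hw⟩
  · rw [norm_pow, norm_neg] at hw
    exact Or.inl ⟨n, by simpa using key n hw, rfl⟩
  · rw [norm_pow, norm_neg, Complex.norm_conj] at hw
    exact Or.inr ⟨n, by simpa using key n hw, rfl⟩

/-- The constant term of `b^s` is `b(0)^s = (-l)^s` for `s > 0`, and negative `s` gives the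
conjugates. -/
theorem mem_resonances_iff {l w : ℂ} :
    w ∈ resonances l ↔ ∃ s : ℤ, s ≠ 0 ∧ w = blaschkeCoeff l s 0 := by
  have hnat : ∀ n : ℕ, blaschkeCoeff l n 0 = (-l) ^ n := fun n => by
    have := blaschkeCoeff_natCast l n 0
    rwa [Nat.cast_zero, taylorCoeff_zero_right] at this
  have hneg : ∀ n : ℕ, blaschkeCoeff l (-n) 0 = (-(starRingEnd ℂ) l) ^ n := fun n => by
    have := blaschkeCoeff_neg l n 0
    rwa [neg_zero, hnat, map_pow, map_neg] at this
  constructor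
  · rintro (⟨n, hn, rfl⟩ | ⟨n, hn, rfl⟩)
    · exact ⟨n, by omega, (hnat n).symm⟩
    · exact ⟨-n, by omega, (hneg n).symm⟩
  · rintro ⟨s, hs, rfl⟩
    obtain ⟨n, rfl | rfl⟩ := s.eq_nat_or_neg
    · exact Or.inl ⟨n, by omega, hnat n⟩
    · exact Or.inr ⟨n, by omega, hneg n⟩

/-- The characters whose orbit under `T` spreads out only in unstable directions. -/
def unstableCone : Set (ℤ × ℤ) := {n | n.1 ≠ 0 ∧ ¬ OppositeSigns n}

theorem mem_unstableCone_of_mem {l : ℂ} {n n' : ℤ × ℤ} (hn : n ∈ unstableCone)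
    (h : koopmanMatrix l n n' ≠ 0) : n' ∈ unstableCone := by
  obtain ⟨h1, h2, h3⟩ := koopmanMatrix_ne_zero h
  simp only [unstableCone, OppositeSigns, Set.mem_ofPred_eq] at hn ⊢
  omega

/-- From `(0, s)` the first coordinate moves in the direction of the sign of `s` while the second
stays `s`; distinct points of the axis therefore never interact. -/
theorem mem_unstableCone_of_axis {l : ℂ} {n n' : ℤ × ℤ} (hn : n.1 = 0)
    (hne : n' ≠ n) (h : koopmanMatrix l n n' ≠ 0) : n' ∈ unstableCone := by
  obtain ⟨h1, h2, h3⟩ := koopmanMatrix_ne_zero h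
  have hne' : ¬ (n'.1 = n.1 ∧ n'.2 = n.2) := fun h => hne (Prod.ext h.1 h.2)
  simp only [unstableCone, OppositeSigns, Set.mem_ofPred_eq]
  omega

theorem koopmanMatrix_self_eq_zero {l : ℂ} {n : ℤ × ℤ} (hn : n.1 ≠ 0) :
    koopmanMatrix l n n = 0 := by
  by_contra h
  have := (koopmanMatrix_ne_zero h).1
  omega

/-- This expresses invariance of Haar measure under `T`: non-trivial characters keep mean zero. It
allows the zero frequency to be dropped from the recursion. -/
theorem koopmanMatrix_zero_right {l : ℂ} {n : ℤ × ℤ} (hn : n ≠ 0) : koopmanMatrix l n 0 = 0 := by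
  by_contra h
  obtain ⟨h1, h2, h3⟩ := koopmanMatrix_ne_zero h
  simp only [Prod.fst_zero, Prod.snd_zero] at h1 h2 h3
  exact hn (Prod.ext (by simp only [Prod.fst_zero]; omega) (by simp only [Prod.snd_zero]; omega))

end Resonances

/-! ### Generating series of correlations and the extremal characters -/

section Correlations

variable {l : ℂ} (hl : ‖l‖ < 1)

theorem charCorrelation_zero {g : Torus → ℂ} {c : ℤ × ℤ → ℂ} (hc : Summable fun n => ‖c n‖)
    (hg : ∀ z, HasSum (fun n => c n * torusChar n z) (g z)) (n : ℤ × ℤ) :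
    charCorrelation hl g 0 n = c (-n) := by
  have h := hasSum_integral_mul_series (continuous_torusChar n) hc continuous_torusChar
    (fun n z => (norm_torusChar n z).le) hg
  simp only [← torusChar_add, integral_torusChar] at h
  have h2 : HasSum (fun m => c m * if n + m = 0 then 1 else 0) (c (-n)) := by
    convert hasSum_ite_eq (-n) (c (-n)) using 2 with m
    by_cases hm : m = -n
    · simp [hm]
    · have : n + m ≠ 0 := fun h => hm (eq_neg_of_add_eq_zero_right h)
      simp [hm, this]
  rw [h2.unique h, charCorrelation]
  congr 1
  ext z
  exact mul_comm _ _

theorem norm_charCorrelation_le {g : Torus → ℂ} (hg : Continuous g) :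
    ∃ C, ∀ k n, ‖charCorrelation hl g k n‖ ≤ C := by
  obtain ⟨A, hA⟩ := isCompact_univ.exists_bound_of_continuousOn hg.continuousOn
  exact ⟨A, fun k n => norm_integral_le fun z => by
    rw [norm_mul, norm_torusChar, mul_one]
    exact hA z (Set.mem_univ _)⟩

/-- Subtracting the product of the means is the same as deleting the zero frequency, which removes
the eigenvalue `1`. -/
theorem hasSum_correlation {g h : Torus → ℂ} (hg : Continuous g) {c : ℤ × ℤ → ℂ}
    (hc : Summable fun n => ‖c n‖) (hh : ∀ z, HasSum (fun n => c n * torusChar n z) (h z))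
    (k : ℕ) : HasSum (fun n => c n * if n = 0 then 0 else charCorrelation hl g k n)
      (correlation l hl g h k) := by
  have h0 : ∫ z, h z ∂haar = c 0 := by
    have := charCorrelation_zero hl hc hh 0
    simpa [charCorrelation, torusChar_zero] using this
  have h1 : charCorrelation hl g k 0 = ∫ z, g z ∂haar := by
    simp [charCorrelation, torusChar_zero]
  have h2 := (hasSum_charCorrelation hl hg hc hh k).sub
    (hasSum_ite_eq (0 : ℤ × ℤ) (c 0 * charCorrelation hl g k 0))
  rw [correlation, h0, ← h1, mul_comm _ (c 0)]
  have he : (fun n => c n * if n = 0 then 0 else charCorrelation hl g k n) = fun n =>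
      c n * charCorrelation hl g k n - if n = 0 then c 0 * charCorrelation hl g k 0 else 0 := by
    ext n
    by_cases hn : n = 0 <;> simp [hn]
  rw [he]
  exact h2

theorem exists_extension_correlation {g h : Torus → ℂ} (hg : AnalyticNearTorus g)
    (hh : AnalyticNearTorus h) {ε : ℝ} (hε : 0 < ε) :
    ∃ P G : ℂ → ℂ, AnalyticOnNhd ℂ P Set.univ ∧
      (∀ x, P x = 0 → ∃ w ∈ resonances l, x * w = 1) ∧ AnalyticOnNhd ℂ G (Metric.ball 0 ε⁻¹) ∧
      ∀ᶠ x in 𝓝 (0 : ℂ), G x = P x * ∑' k, x ^ k * correlation l hl g h k := by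
  obtain ⟨a, q₁, A, hq₁, hq₁1, ha, hga⟩ := hg.exists_series
  obtain ⟨b, q₂, B, hq₂, hq₂1, hb, hhb⟩ := hh.exists_series
  have hA0 : 0 ≤ A := by simpa using (norm_nonneg _).trans (ha 0)
  have hB0 : 0 ≤ B := by simpa using (norm_nonneg _).trans (hb 0)
  have has : Summable fun n => ‖a n‖ := Summable.of_nonneg_of_le (fun _ => norm_nonneg _) ha
    ((summable_pow_natAbs hq₁ hq₁1).mul_left A)
  have hbs : Summable fun n => ‖b n‖ := Summable.of_nonneg_of_le (fun _ => norm_nonneg _) hb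
    ((summable_pow_natAbs hq₂ hq₂1).mul_left B)
  have hgc := hg.continuous
  -- The weight lies between `q ^ |n|` and a multiple of `q ^ (-|n|)`. The condition `q₁ ≤ q` makes
  -- the initial vector bounded after division by the weight, and `q₂ ≤ q * q` leaves a summable `q
  -- ^ |n|` after the coefficients of `h` are multiplied by it.
  obtain ⟨q, hq, hq1, hq₁q, hq₂q⟩ : ∃ q : ℝ, 0 < q ∧ q < 1 ∧ q₁ ≤ q ∧ q₂ ≤ q * q := by
    refine ⟨Real.sqrt (max q₁ q₂), Real.sqrt_pos.mpr (lt_max_of_lt_left hq₁), ?_, ?_, ?_⟩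
    · rw [Real.sqrt_lt' one_pos]
      simpa using ⟨hq₁1, hq₂1⟩
    · refine Real.le_sqrt_of_sq_le ((?_ : q₁ ^ 2 ≤ q₁).trans (le_max_left _ _))
      nlinarith
    · rw [Real.mul_self_sqrt (hq₁.le.trans (le_max_left _ _))]
      exact le_max_right _ _
  obtain ⟨v, K, R, hv0, hvl, hvu, hvs, hvr⟩ := exists_weight hl hq hq1 hε
  let φ : ℕ → ℤ × ℤ → ℂ := fun k n => if n = 0 then 0 else charCorrelation hl g k n
  let N : ℤ × ℤ → ℤ × ℤ → ℂ := fun n n' =>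
    if n = 0 ∨ n' = n ∧ n.2.natAbs < R then 0 else koopmanMatrix l n n'
  let S : Finset (ℤ × ℤ) := ((Finset.Ioo (-(R : ℤ)) R).erase 0).image fun s => (0, s)
  have hS : ∀ n, n ∈ S ↔ n.1 = 0 ∧ n.2 ≠ 0 ∧ n.2.natAbs < R := by
    rintro ⟨n₁, n₂⟩
    simp only [S, Finset.mem_image, Finset.mem_erase, Finset.mem_Ioo, Prod.mk.injEq]
    constructor
    · rintro ⟨s, ⟨h1, h2, h3⟩, rfl, rfl⟩
      exact ⟨rfl, h1, by omega⟩
    · rintro ⟨rfl, h1, h2⟩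
      exact ⟨n₂, ⟨h1, by omega, by omega⟩, rfl, rfl⟩
  have hNM : ∀ {n n'}, N n n' ≠ 0 →
      koopmanMatrix l n n' ≠ 0 ∧ n ≠ 0 ∧ ¬ (n' = n ∧ n.2.natAbs < R) := fun {n n'} h => by
    simp only [N] at h
    split_ifs at h with h1
    · exact absurd rfl h
    · exact ⟨h, fun h2 => h1 (Or.inl h2), fun h2 => h1 (Or.inr h2)⟩
  -- Conjugation by the weight turns weighted row sums into ordinary ones; diagonal entries, hence
  -- the loops, are unaffected.
  let N' : ℤ × ℤ → ℤ × ℤ → ℂ := fun n n' => N n n' * v n' / v n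
  have hN'N : ∀ {n n'}, N' n n' ≠ 0 → N n n' ≠ 0 := fun {n n'} h h0 => h (by simp [N', h0])
  have hN'le : ∀ n ≠ 0, ∀ n', ‖N' n n'‖ = (if n' = n ∧ n.2.natAbs < R then 0 else
      ‖koopmanMatrix l n n'‖ * v n') / v n := fun n hn n' => by
    simp only [N', N, hn, false_or, norm_div, norm_mul, Complex.norm_real,
      Real.norm_of_nonneg (hv0 _).le]
    split_ifs <;> simp
  have hN'0 : ∀ n', N' 0 n' = 0 := fun n' => by simp [N', N]
  have hrows : ∀ n, Summable fun n' => if n' = n ∧ n.2.natAbs < R then 0 else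
      ‖koopmanMatrix l n n'‖ * v n' := fun n => by
    refine Summable.of_nonneg_of_le (fun n' => ?_) (fun n' => ?_) (hvs n) <;>
    · have := mul_nonneg (norm_nonneg (koopmanMatrix l n n')) (hv0 n').le
      split_ifs <;> simp [this]
  have hN's : ∀ n, Summable fun n' => ‖N' n n'‖ := fun n => by
    by_cases hn : n = 0
    · subst hn
      simp only [hN'0, norm_zero]
      exact summable_zero
    · simp only [hN'le n hn]
      exact (hrows n).div_const _
  have hN'b : ∀ n, ∑' n', ‖N' n n'‖ ≤ ε := fun n => by
    by_cases hn : n = 0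
    · subst hn
      simp [hN'0, hε.le]
    · simp only [hN'le n hn]
      rw [tsum_div_const, div_le_iff₀ (hv0 n)]
      exact hvr n hn
  have hvc : ∀ n, (v n : ℂ) ≠ 0 := fun n => by exact_mod_cast (hv0 n).ne'
  obtain ⟨D, hD⟩ := norm_charCorrelation_le hl hgc
  have hrec : ∀ k n, φ (k + 1) n = ∑' n', N n n' * φ k n' +
      if n ∈ S then koopmanMatrix l n n * φ k n else 0 := by
    intro k n
    by_cases hn : n = 0
    · subst hn
      simp [φ, N, hS]
    have hφ : HasSum (fun n' => koopmanMatrix l n n' * φ k n') (φ (k + 1) n) := by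
      have h1 := hasSum_charCorrelation_succ hl hgc k n
      have h2 : (fun n' => koopmanMatrix l n n' * φ k n') =
          fun n' => koopmanMatrix l n n' * charCorrelation hl g k n' := by
        ext n'
        by_cases hn' : n' = 0
        · simp [hn', koopmanMatrix_zero_right hn]
        · simp [φ, hn']
      rw [h2]
      simpa only [φ, hn, if_false] using h1
    by_cases hnS : n ∈ S
    · rw [if_pos hnS, ← hφ.tsum_eq, hφ.summable.tsum_eq_add_tsum_ite n, add_comm]
      congr 2
      ext n'
      have := ((hS n).mp hnS).2.2
      by_cases hn' : n' = n <;> simp [N, hn, hn', this]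
    · rw [if_neg hnS, add_zero, ← hφ.tsum_eq]
      congr 1
      ext n'
      simp only [N, hn, false_or]
      split_ifs with h1
      -- The cutoff in `N` also deletes diagonal entries off the axis, but those are zero.
      · have hn1 : n.1 ≠ 0 := fun h0 => by
          refine hnS ((hS n).mpr ⟨h0, fun h2 => hn (Prod.ext h0 h2), h1.2⟩)
        rw [h1.1, koopmanMatrix_self_eq_zero hn1]
      · rfl
  obtain ⟨G, hG, hGs⟩ := exists_analytic_extension N' hε hN's hN'b S unstableCone
    (fun s hs hQ => hQ.1 ((hS s).mp hs).1)
    (fun n hn n' h => mem_unstableCone_of_mem hn (hNM (hN'N h)).1)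
    (fun n hn n' h => by
      obtain ⟨h1, -, h3⟩ := (hS n).mp hn
      obtain ⟨h4, -, h5⟩ := hNM (hN'N h)
      exact mem_unstableCone_of_axis h1 (fun he => h5 ⟨he, h3⟩) h4)
    (fun n => koopmanMatrix l n n) (fun k n => φ k n / v n) (C := A)
    (fun n => by
      simp only [φ]
      split_ifs with hn
      · simpa using hA0
      · rw [charCorrelation_zero hl has hga, norm_div, Complex.norm_real,
          Real.norm_of_nonneg (hv0 _).le, div_le_iff₀ (hv0 n)]
        calc _ ≤ A * q₁ ^ (n.1.natAbs + n.2.natAbs) := by simpa using ha (-n)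
          _ ≤ A * q ^ (n.1.natAbs + n.2.natAbs) := by gcongr
          _ ≤ _ := by gcongr; exact hvl n)
    (fun k n => by
      rw [hrec, add_div, ← tsum_div_const]
      congr 1
      · congr 1
        ext n'
        simp only [N']
        have := hvc n'
        field_simp
      · split_ifs
        · rw [mul_div_assoc]
        · simp)
    (fun n => b n * v n) (by
      refine Summable.of_nonneg_of_le (fun _ => norm_nonneg _) (fun n => ?_)
        ((summable_pow_natAbs hq hq1).mul_left (B * K))
      rw [norm_mul, Complex.norm_real, Real.norm_of_nonneg (hv0 n).le]
      have hqn : q ^ (n.1.natAbs + n.2.natAbs) ≠ 0 := by positivity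
      calc _ ≤ (B * q₂ ^ (n.1.natAbs + n.2.natAbs)) * (K * (q ^ (n.1.natAbs + n.2.natAbs))⁻¹) :=
            mul_le_mul (hb n) (hvu n) (hv0 n).le (by positivity)
        _ ≤ (B * (q * q) ^ (n.1.natAbs + n.2.natAbs)) *
            (K * (q ^ (n.1.natAbs + n.2.natAbs))⁻¹) := by
            have := (hv0 n).le.trans (hvu n)
            gcongr
        _ = _ := by
            rw [mul_pow]
            field_simp)
  refine ⟨fun x => ∏ s ∈ S, (1 - x * koopmanMatrix l s s), G, fun x _ => by fun_prop, ?_, hG, ?_⟩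
  · intro x hx
    obtain ⟨s, hs, hs0⟩ := Finset.prod_eq_zero_iff.mp hx
    obtain ⟨h1, h2, -⟩ := (hS s).mp hs
    refine ⟨koopmanMatrix l s s, ?_, (sub_eq_zero.mp hs0).symm⟩
    exact mem_resonances_iff.mpr ⟨s.2, h2, koopmanMatrix_self l h1⟩
  · filter_upwards [hGs] with x hx
    rw [hx]
    congr 2
    ext k
    rw [← (hasSum_correlation hl hgc hbs hhb k).tsum_eq]
    congr 2
    ext n
    have := hvc n
    simp only [φ]
    field_simp

/-- Both claims go through one induction: the correlations vanish on the invariant unstable cone, so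
at `(0, s)` the recursion retains only the loop. -/
theorem charCorrelation_axis (s : ℤ) (k : ℕ) :
    (∀ n ∈ unstableCone, charCorrelation hl (torusChar (0, -s)) k n = 0) ∧
      charCorrelation hl (torusChar (0, -s)) k (0, s) = blaschkeCoeff l s 0 ^ k := by
  induction k with
  | zero =>
    have h0 : ∀ n, charCorrelation hl (torusChar (0, -s)) 0 n =
        if (0, -s) + n = 0 then 1 else 0 := fun n => by
      rw [← integral_torusChar]
      simp only [charCorrelation, torusChar_add, Function.iterate_zero, id_eq]
    refine ⟨fun n hn => ?_, ?_⟩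
    · rw [h0, if_neg]
      intro h
      exact hn.1 (by simpa using congrArg Prod.fst h)
    · rw [h0, if_pos (by simp), pow_zero]
  | succ k ih =>
    have hrec := hasSum_charCorrelation_succ hl (continuous_torusChar (0, -s)) k
    refine ⟨fun n hn => ?_, ?_⟩
    · refine (hrec n).unique ?_
      convert hasSum_zero using 2 with n'
      by_cases h : koopmanMatrix l n n' = 0
      · rw [h, zero_mul]
      · rw [ih.1 n' (mem_unstableCone_of_mem hn h), mul_zero]
    · refine (hrec (0, s)).unique ?_
      have h := hasSum_single (f := fun n' => koopmanMatrix l (0, s) n' *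
        charCorrelation hl (torusChar (0, -s)) k n') (0, s) fun n' hn' => by
          by_cases h : koopmanMatrix l (0, s) n' = 0
          · rw [h, zero_mul]
          · rw [ih.1 n' (mem_unstableCone_of_axis rfl hn' h), mul_zero]
      rwa [ih.2, koopmanMatrix_self l rfl, ← pow_succ'] at h

theorem correlation_axis {s : ℤ} (hs : s ≠ 0) (k : ℕ) :
    correlation l hl (torusChar (0, -s)) (torusChar (0, s)) k = blaschkeCoeff l s 0 ^ k := by
  rw [← (charCorrelation_axis hl s k).2, correlation, integral_torusChar (0, s),
    if_neg (by simpa using hs), mul_zero, sub_zero, charCorrelation]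

end Correlations

/-! ### The geometric model with a single pole -/

section Poles

theorem meromorphic_div_sub (w : ℂ) (ζ : ℂ) : MeromorphicAt (fun ζ : ℂ => ζ / (ζ - w)) ζ := by
  fun_prop

theorem isMeromorphicContinuation_geometric {w : ℂ} (hw : ‖w‖ < 1) :
    IsMeromorphicContinuation (fun k => w ^ k) fun ζ => ζ / (ζ - w) := by
  refine ⟨fun ζ _ => meromorphic_div_sub w ζ, fun ζ hζ => ?_⟩
  have hζ0 : ζ ≠ 0 := norm_pos_iff.mp (one_pos.trans hζ)
  have hne : ζ - w ≠ 0 := fun h => by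
    rw [sub_eq_zero.mp h] at hζ
    linarith
  have hr : ‖w / ζ‖ < 1 := by
    rw [norm_div, div_lt_one (one_pos.trans hζ)]
    linarith
  have he : (fun k : ℕ => ζ ^ (-(k : ℤ)) * w ^ k) = fun k => (w / ζ) ^ k := by
    ext k
    rw [zpow_neg, zpow_natCast, div_pow, div_eq_inv_mul]
  rw [zTransform, he, tsum_geometric_of_norm_lt_one hr]
  field_simp

/-- The pole is simple because the numerator equals `w ≠ 0` there; for `w = 0` it would cancel. -/
theorem isPole_div_sub {w : ℂ} (hw : w ≠ 0) : IsPole (fun ζ : ℂ => ζ / (ζ - w)) w := by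
  refine ⟨meromorphic_div_sub w w, ?_⟩
  have h : meromorphicOrderAt (fun ζ : ℂ => ζ / (ζ - w)) w = ((-1 : ℤ) : WithTop ℤ) := by
    rw [meromorphicOrderAt_eq_int_iff (meromorphic_div_sub w w)]
    refine ⟨id, analyticAt_id, hw, Eventually.of_forall fun ζ => ?_⟩
    simp [div_eq_inv_mul]
  rw [h]
  decide

end Poles

end BlaschkeTorus

end

theorem corollary2 (l : ℂ) (hl : ‖l‖ < 1) :
    (∀ g h : BlaschkeTorus.Torus → ℂ,
      BlaschkeTorus.AnalyticNearTorus g → BlaschkeTorus.AnalyticNearTorus h →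
        (∀ ζ : ℂ, 1 < ‖ζ‖ →
          Summable fun k : ℕ => ζ ^ (-(k : ℤ)) * BlaschkeTorus.correlation l hl g h k) ∧
        ∃ F : ℂ → ℂ,
          BlaschkeTorus.IsMeromorphicContinuation (BlaschkeTorus.correlation l hl g h) F ∧
          ∀ ζ : ℂ, ζ ≠ 0 → ζ ∉ BlaschkeTorus.resonances l → AnalyticAt ℂ F ζ) ∧
    (∀ w ∈ BlaschkeTorus.resonances l, w ≠ 0 →
      ∃ g h : BlaschkeTorus.Torus → ℂ,
        BlaschkeTorus.AnalyticNearTorus g ∧ BlaschkeTorus.AnalyticNearTorus h ∧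
        ∃ F : ℂ → ℂ,
          BlaschkeTorus.IsMeromorphicContinuation (BlaschkeTorus.correlation l hl g h) F ∧
          BlaschkeTorus.IsPole F w) := by
  refine ⟨fun g h hg hh => ?_, fun w hw hw0 => ?_⟩
  · obtain ⟨C, hC⟩ := BlaschkeTorus.correlation_bounded hl hg.continuous hh.continuous
    exact ⟨fun ζ hζ => BlaschkeTorus.summable_zpow_neg_mul hC hζ,
      BlaschkeTorus.exists_continuation hC (fun ε hε => BlaschkeTorus.finite_resonances hl hε)
        (fun w hw => BlaschkeTorus.norm_lt_one_of_mem_resonances hl hw)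
        fun ε hε => BlaschkeTorus.exists_extension_correlation hl hg hh hε⟩
  · obtain ⟨s, hs, rfl⟩ := BlaschkeTorus.mem_resonances_iff.mp hw
    refine ⟨_, _, BlaschkeTorus.analyticNearTorus_torusChar (0, -s),
      BlaschkeTorus.analyticNearTorus_torusChar (0, s), _, ?_, BlaschkeTorus.isPole_div_sub hw0⟩
    rw [funext (BlaschkeTorus.correlation_axis hl hs)]
    exact BlaschkeTorus.isMeromorphicContinuation_geometric
      (BlaschkeTorus.norm_lt_one_of_mem_resonances hl hw)
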